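/- Let $a_{11},a_{12},a_{21},a_{22}\in\mathbb{R}$ and, for a delay $\tau\ge 0$, consider the system $$\dot r(t)=a_{11}r(t)+a_{12}j(t-\tau),\qquad \dot j(t)=a_{21}r(t)+a_{22}j(t)\qquad(t\ge 0),$$ with continuous initial data on $[-\tau,0]$. Call the system *stable* (for the delay $\tau$) if every solution $(r(t),j(t))$ tends to the equilibrium $(0,0)$ as $t\to+\infty$, and *unstable* if it has a solution that is unbounded on $[0,\infty)$. A *stability switch* is a delay $\tau_c>0$ at which the system changes from stable to unstable or vice versa as $\tau$ increases: for some $\varepsilon>0$ it is stable for all $\tau\in(\tau_c-\varepsilon,\tau_c)$ and unstable for all $\tau\in(\tau_c,\tau_c+\varepsilon)$, or the other way round. If $|a_{12}a_{21}|<|a_{11}a_{22}|$, then there are no stability switches: the system is either stable for all $\tau\ge 0$ or unstable for all $\tau\ge 0$. If $|a_{12}a_{21}|>|a_{11}a_{22}|$, then: 1. if the system is unstable for $\tau=0$, then it is unstable for all $\tau\ge 0$; 2. if the system is stable for $\tau=0$, then there is exactly one stability switch $\tau_c>0$; moreover, the system is stable for all $0\le\tau<\tau_c$ and unstable for all $\tau>\tau_c$.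 -/

import Mathlib

open Filter Topology

/-- `(r, j)` is a (forward) solution, with some continuous initial history on `[-τ, 0]`, of
`r'(t) = a₁₁ r(t) + a₁₂ j(t - τ)`, `j'(t) = a₂₁ r(t) + a₂₂ j(t)` for `t ≥ 0`
(with the right derivative at `t = 0`). -/
structure IsDyadSolution (a₁₁ a₁₂ a₂₁ a₂₂ τ : ℝ) (r j : ℝ → ℝ) : Prop where
  continuousOn_r : ContinuousOn r (Set.Ici (-τ))
  continuousOn_j : ContinuousOn j (Set.Ici (-τ))
  deriv_r : ∀ t : ℝ, 0 ≤ t →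
    HasDerivWithinAt r (a₁₁ * r t + a₁₂ * j (t - τ)) (Set.Ici 0) t
  deriv_j : ∀ t : ℝ, 0 ≤ t →
    HasDerivWithinAt j (a₂₁ * r t + a₂₂ * j t) (Set.Ici 0) t

/-- The system with delay `τ` is stable: every solution tends to the equilibrium `(0, 0)`. -/
def DyadStable (a₁₁ a₁₂ a₂₁ a₂₂ τ : ℝ) : Prop :=
  ∀ r j : ℝ → ℝ, IsDyadSolution a₁₁ a₁₂ a₂₁ a₂₂ τ r j →
    Tendsto (fun t => (r t, j t)) atTop (𝓝 (0, 0))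

/-- The system with delay `τ` is unstable: it has a solution that is unbounded in forward
time. Systems that are Lyapunov stable without being attracting are neither stable nor
unstable in this sense. -/
def DyadUnstable (a₁₁ a₁₂ a₂₁ a₂₂ τ : ℝ) : Prop :=
  ∃ r j : ℝ → ℝ, IsDyadSolution a₁₁ a₁₂ a₂₁ a₂₂ τ r j ∧
    ∀ C : ℝ, ∃ t : ℝ, 0 ≤ t ∧ C < max |r t| |j t|

/-- A stability switch at the delay `τc > 0`: as the delay increases through `τc`, the system
changes from stable to unstable or from unstable to stable. -/
def IsStabilitySwitch (a₁₁ a₁₂ a₂₁ a₂₂ τc : ℝ) : Prop :=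
  0 < τc ∧
    (((∀ᶠ τ in 𝓝[<] τc, DyadStable a₁₁ a₁₂ a₂₁ a₂₂ τ) ∧
        (∀ᶠ τ in 𝓝[>] τc, DyadUnstable a₁₁ a₁₂ a₂₁ a₂₂ τ)) ∨
      ((∀ᶠ τ in 𝓝[<] τc, DyadUnstable a₁₁ a₁₂ a₂₁ a₂₂ τ) ∧
        (∀ᶠ τ in 𝓝[>] τc, DyadStable a₁₁ a₁₂ a₂₁ a₂₂ τ)))

/-! Write `a = a₁₁`, `b = a₂₂`, `k = a₁₂a₂₁`. The behaviour is read off the roots of `(z - a)(z - b)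
- k exp(-zτ)`. A root with positive real part gives an unbounded exponential solution
(`dyadUnstable_of_root`). If the closed right half plane contains no root, the Laplace transform of
a solution continues to the imaginary axis, and a contour shift followed by the Riemann–Lebesgue
lemma gives decay (`tendsto_zero_of_no_root`).

It remains to locate roots. If `|k| < |ab|` and `a, b < 0`, then `|z - a||z - b| ≥ |ab| > |k
exp(-zτ)|` for `Re z ≥ 0`, so there are none; for other signs every delay has a root with positive
real part. If `|k| > |ab|` and `k > 0`, the characteristic function is negative at `0`, which forces
a positive real root.

The essential case is `k = -K < 0`, `K > |ab|`. A root in the upper half plane satisfies `|z - a||z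
- b| = K exp(-τ Re z)`, and `arg(z - a) + arg(z - b) + τ Im z` is an odd multiple of `π`. Where this
curve meets the imaginary axis, the phase is affine and increasing in `τ`; it equals `π` at
`criticalDelay`, which is positive when `a + b < 0`. Once it exceeds `π`, following the curve to
large `Re z`, where the phase is `0`, yields a root with positive real part
(`exists_root_of_charPhase`). This works for all larger delays at once, so no crossing direction has
to be computed. Below the critical delay no root lies on the axis, so none can have entered from the
left since `τ = 0` (`no_root_of_lt_criticalDelay`). If `a + b > 0`, the phase exceeds `π` from the
start; if `a + b = 0`, the undelayed system is a center, neither stable nor unstable. -/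

/-! ### Exponential solutions from characteristic roots -/

/-- The characteristic function of the delayed system. -/
noncomputable def dyadChar (a₁₁ a₁₂ a₂₁ a₂₂ τ : ℝ) (z : ℂ) : ℂ :=
  (z - a₁₁) * (z - a₂₂) - a₁₂ * a₂₁ * Complex.exp (-z * τ)

theorem exists_dyad_eigenvector {a₁₁ a₁₂ a₂₁ a₂₂ τ : ℝ} {z : ℂ}
    (hz : dyadChar a₁₁ a₁₂ a₂₁ a₂₂ τ z = 0) :
    ∃ u w : ℂ, (u ≠ 0 ∨ w ≠ 0) ∧ (z - a₁₁) * u = a₁₂ * Complex.exp (-z * τ) * w ∧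
      (z - a₂₂) * w = a₂₁ * u := by
  unfold dyadChar at hz
  by_cases h1 : (z - a₂₂ ≠ 0 ∨ (a₂₁ : ℂ) ≠ 0)
  -- The two columns of the adjugate matrix are tried in turn; if both vanish, the matrix is zero
  -- and any vector is in the kernel.
  · exact ⟨z - a₂₂, a₂₁, h1, by linear_combination hz, by ring⟩
  · push Not at h1
    by_cases h2 : ((a₁₂ : ℂ) * Complex.exp (-z * τ) ≠ 0 ∨ z - a₁₁ ≠ 0)
    · exact ⟨_, _, h2, by ring, by rw [h1.1, h1.2]; ring⟩
    · push Not at h2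
      exact ⟨1, 0, by simp, by rw [h2.2]; ring, by rw [h1.2]; ring⟩

theorem isDyadSolution_re_exp {a₁₁ a₁₂ a₂₁ a₂₂ τ : ℝ} {z u w : ℂ}
    (h1 : (z - a₁₁) * u = a₁₂ * Complex.exp (-z * τ) * w) (h2 : (z - a₂₂) * w = a₂₁ * u) :
    IsDyadSolution a₁₁ a₁₂ a₂₁ a₂₂ τ (fun t => (Complex.exp (z * t) * u).re)
      (fun t => (Complex.exp (z * t) * w).re) := by
  have hd : ∀ (v : ℂ) (t : ℝ), HasDerivAt (fun t : ℝ => (Complex.exp (z * t) * v).re)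
      (Complex.exp (z * t) * (z * v)).re t := by
    intro v t
    have h : HasDerivAt (fun s : ℂ => Complex.exp (z * s) * v)
        (Complex.exp (z * t) * (z * v)) (t : ℂ) := by
      have := (((hasDerivAt_id (t : ℂ)).const_mul z).cexp).mul_const v
      exact this.congr_deriv (by simp [mul_assoc])
    exact h.real_of_complex
  refine ⟨?_, ?_, ?_, ?_⟩
  · exact (continuous_iff_continuousAt.2 fun t => (hd u t).continuousAt).continuousOn
  · exact (continuous_iff_continuousAt.2 fun t => (hd w t).continuousAt).continuousOn
  · intro t _
    refine (hd u t).hasDerivWithinAt.congr_deriv ?_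
    have e : Complex.exp (z * (t - τ : ℝ)) = Complex.exp (z * t) * Complex.exp (-z * τ) := by
      rw [← Complex.exp_add]; congr 1; push_cast; ring
    have : Complex.exp (z * t) * (z * u)
        = a₁₁ * (Complex.exp (z * t) * u) + a₁₂ * (Complex.exp (z * (t - τ : ℝ)) * w) := by
      rw [e]; linear_combination Complex.exp (z * t) * h1
    rw [this, Complex.add_re, Complex.re_ofReal_mul, Complex.re_ofReal_mul]
  · intro t _
    refine (hd w t).hasDerivWithinAt.congr_deriv ?_
    have : Complex.exp (z * t) * (z * w)
        = a₂₁ * (Complex.exp (z * t) * u) + a₂₂ * (Complex.exp (z * t) * w) := by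
      linear_combination Complex.exp (z * t) * h2
    rw [this, Complex.add_re, Complex.re_ofReal_mul, Complex.re_ofReal_mul]

theorem norm_exp_mul_ofReal (z v : ℂ) (t : ℝ) :
    ‖Complex.exp (z * t) * v‖ = Real.exp (z.re * t) * ‖v‖ := by
  rw [norm_mul, Complex.norm_exp, Complex.re_mul_ofReal]

theorem im_eq_re_neg_I_mul (e v : ℂ) : (e * v).im = (e * (-Complex.I * v)).re := by
  simp; ring

theorem dyadUnstable_of_root {a₁₁ a₁₂ a₂₁ a₂₂ τ : ℝ} {z : ℂ}
    (hz : dyadChar a₁₁ a₁₂ a₂₁ a₂₂ τ z = 0) (hre : 0 < z.re) :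
    DyadUnstable a₁₁ a₁₂ a₂₁ a₂₂ τ := by
  obtain ⟨u, w, hne, h1, h2⟩ := exists_dyad_eigenvector hz
  by_contra hcon
  have key : ∀ r j, IsDyadSolution a₁₁ a₁₂ a₂₁ a₂₂ τ r j →
      ∃ C, ∀ t : ℝ, 0 ≤ t → |r t| ≤ C ∧ |j t| ≤ C := by
    intro r j hs
    unfold DyadUnstable at hcon
    push Not at hcon
    obtain ⟨C, hC⟩ := hcon r j hs
    exact ⟨C, fun t ht => max_le_iff.1 (hC t ht)⟩
  obtain ⟨C, hC⟩ := key _ _ (isDyadSolution_re_exp h1 h2)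
  -- Multiplying the eigenvector by `-i` turns the imaginary part of the complex solution into a
  -- real part, so the modulus is controlled by two real solutions.
  obtain ⟨C', hC'⟩ := key _ _ (isDyadSolution_re_exp (z := z) (u := -Complex.I * u) (w := -Complex.I * w)
    (by linear_combination -Complex.I * h1) (by linear_combination -Complex.I * h2))
  have bound : ∀ v : ℂ, (∀ t : ℝ, 0 ≤ t → |(Complex.exp (z * t) * v).re| ≤ C) →
      (∀ t : ℝ, 0 ≤ t → |(Complex.exp (z * t) * (-Complex.I * v)).re| ≤ C') → v = 0 := by
    intro v hv hv'
    by_contra hv0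
    have hpos : 0 < ‖v‖ := norm_pos_iff.2 hv0
    have ht : Tendsto (fun t : ℝ => Real.exp (z.re * t) * ‖v‖) atTop atTop :=
      (Real.tendsto_exp_atTop.comp (tendsto_id.const_mul_atTop hre)).atTop_mul_const hpos
    obtain ⟨t, ht0, ht1⟩ := ((eventually_ge_atTop 0).and (ht.eventually_gt_atTop (C + C'))).exists
    have := Complex.norm_le_abs_re_add_abs_im (Complex.exp (z * t) * v)
    rw [norm_exp_mul_ofReal, im_eq_re_neg_I_mul] at this
    linarith [hv t ht0, hv' t ht0]
  rcases hne with h | h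
  · exact h (bound u (fun t ht => (hC t ht).1) (fun t ht => (hC' t ht).1))
  · exact h (bound w (fun t ht => (hC t ht).2) (fun t ht => (hC' t ht).2))

theorem not_dyadStable_of_root {a₁₁ a₁₂ a₂₁ a₂₂ τ : ℝ} {z : ℂ}
    (hz : dyadChar a₁₁ a₁₂ a₂₁ a₂₂ τ z = 0) (hre : 0 ≤ z.re) :
    ¬ DyadStable a₁₁ a₁₂ a₂₁ a₂₂ τ := by
  obtain ⟨u, w, hne, h1, h2⟩ := exists_dyad_eigenvector hz
  intro hst
  have hC := hst _ _ (isDyadSolution_re_exp h1 h2)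
  have hC' := hst _ _ (isDyadSolution_re_exp (z := z) (u := -Complex.I * u) (w := -Complex.I * w)
    (by linear_combination -Complex.I * h1) (by linear_combination -Complex.I * h2))
  rw [Prod.tendsto_iff] at hC hC'
  have bound : ∀ v : ℂ, Tendsto (fun t : ℝ => (Complex.exp (z * t) * v).re) atTop (𝓝 0) →
      Tendsto (fun t : ℝ => (Complex.exp (z * t) * (-Complex.I * v)).re) atTop (𝓝 0) →
      v = 0 := by
    intro v hv hv'
    have h := hv.abs.add hv'.abs
    simp only [abs_zero, add_zero] at h
    have hle : ‖v‖ ≤ 0 := by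
      refine ge_of_tendsto h ?_
      filter_upwards [eventually_ge_atTop 0] with t ht
      have := Complex.norm_le_abs_re_add_abs_im (Complex.exp (z * t) * v)
      rw [norm_exp_mul_ofReal, im_eq_re_neg_I_mul] at this
      have h1 : 1 ≤ Real.exp (z.re * t) := Real.one_le_exp (mul_nonneg hre ht)
      nlinarith [norm_nonneg v]
    exact norm_le_zero_iff.1 hle
  rcases hne with h | h
  · exact h (bound u hC.1 hC'.1)
  · exact h (bound w hC.2 hC'.2)

theorem DyadUnstable.not_dyadStable {a₁₁ a₁₂ a₂₁ a₂₂ τ : ℝ} (hτ : 0 ≤ τ)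
    (h : DyadUnstable a₁₁ a₁₂ a₂₁ a₂₂ τ) : ¬ DyadStable a₁₁ a₁₂ a₂₁ a₂₂ τ := by
  obtain ⟨r, j, hs, hu⟩ := h
  intro hst
  have ht := hst r j hs
  rw [Prod.tendsto_iff] at ht
  have hm : ∀ f : ℝ → ℝ, ContinuousOn f (Set.Ici (-τ)) → Tendsto f atTop (𝓝 0) →
      ∃ C, ∀ t, 0 ≤ t → |f t| ≤ C := by
    intro f hf hf0
    have h1 : ∀ᶠ t in atTop, |f t| < 1 := by
      have := hf0.abs
      rw [abs_zero] at this
      exact this.eventually_lt_const one_pos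
    obtain ⟨T, hT⟩ := eventually_atTop.1 h1
    obtain ⟨C, hC⟩ := (isCompact_Icc (a := (0 : ℝ)) (b := T)).exists_bound_of_continuousOn
      (hf.mono fun t ht => by simp only [Set.mem_Ici]; linarith [ht.1])
    refine ⟨max C 1, fun t ht => ?_⟩
    rcases le_total t T with h | h
    · exact (hC t ⟨ht, h⟩).trans (le_max_left _ _)
    · exact (hT t h).le.trans (le_max_right _ _)
  obtain ⟨C, hC⟩ := hm r hs.continuousOn_r ht.1
  obtain ⟨C', hC'⟩ := hm j hs.continuousOn_j ht.2
  obtain ⟨t, ht0, htC⟩ := hu (max C C')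
  exact absurd htC (not_lt.2 (max_le_max (hC t ht0) (hC' t ht0)))

/-! ### Level curves of the modulus and the phase along them -/

/-- The `Y` solving `((x - a)² + Y) ((x - b)² + Y) = L²` with `(x - a)² + Y > 0`. -/
noncomputable def levelSq (a b L x : ℝ) : ℝ :=
  (-((x - a) ^ 2 + (x - b) ^ 2) + √(((x - a) ^ 2 - (x - b) ^ 2) ^ 2 + 4 * L ^ 2)) / 2

/-- The point with real part `x` of the closed upper half plane on the level curve
`|z - a| |z - b| = L`, and `x` itself where there is none. -/
noncomputable def levelPoint (a b L x : ℝ) : ℂ := ⟨x, √(levelSq a b L x)⟩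

theorem levelSq_mul (a b L x : ℝ) :
    ((x - a) ^ 2 + levelSq a b L x) * ((x - b) ^ 2 + levelSq a b L x) = L ^ 2 := by
  have h := Real.sq_sqrt (show 0 ≤ ((x - a) ^ 2 - (x - b) ^ 2) ^ 2 + 4 * L ^ 2 by positivity)
  unfold levelSq
  nlinarith

theorem levelSq_comm (a b L x : ℝ) : levelSq a b L x = levelSq b a L x := by
  unfold levelSq
  rw [add_comm ((x - a) ^ 2), show ((x - a) ^ 2 - (x - b) ^ 2) ^ 2
    = ((x - b) ^ 2 - (x - a) ^ 2) ^ 2 by ring]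

theorem levelPoint_comm (a b L x : ℝ) : levelPoint a b L x = levelPoint b a L x := by
  unfold levelPoint
  rw [levelSq_comm]

theorem add_levelSq_pos {L : ℝ} (hL : 0 < L) (a b x : ℝ) : 0 < (x - a) ^ 2 + levelSq a b L x := by
  have h : |(x - a) ^ 2 - (x - b) ^ 2| < √(((x - a) ^ 2 - (x - b) ^ 2) ^ 2 + 4 * L ^ 2) := by
    rw [← Real.sqrt_sq_eq_abs]
    exact Real.sqrt_lt_sqrt (sq_nonneg _) (by nlinarith)
  unfold levelSq
  linarith [neg_abs_le ((x - a) ^ 2 - (x - b) ^ 2)]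

theorem add_levelSq_pos' {L : ℝ} (hL : 0 < L) (a b x : ℝ) : 0 < (x - b) ^ 2 + levelSq a b L x := by
  rw [levelSq_comm]
  exact add_levelSq_pos hL b a x

/-- The sign of `levelSq` decides whether the vertical line at `x` meets the level curve. Where it
is negative, the square root in `levelPoint` is `0` and the point is real. -/
theorem levelSq_neg_iff {L : ℝ} (hL : 0 < L) (a b x : ℝ) :
    levelSq a b L x < 0 ↔ L < |(x - a) * (x - b)| := by
  have h := levelSq_mul a b L x
  have h1 := add_levelSq_pos hL a b x
  have h2 := add_levelSq_pos' hL a b x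
  rw [← abs_of_pos hL, ← sq_lt_sq, mul_pow, ← h, abs_of_pos hL]
  constructor
  · intro hneg
    nlinarith
  · intro hlt
    by_contra hcon
    push Not at hcon
    nlinarith [sq_nonneg (x - a), sq_nonneg (x - b)]

theorem levelSq_pos_iff {L : ℝ} (hL : 0 < L) (a b x : ℝ) :
    0 < levelSq a b L x ↔ |(x - a) * (x - b)| < L := by
  have h := levelSq_mul a b L x
  have h1 := add_levelSq_pos hL a b x
  have h2 := add_levelSq_pos' hL a b x
  rw [← abs_of_pos hL, ← sq_lt_sq, mul_pow, ← h, abs_of_pos hL]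
  constructor
  · intro hpos
    nlinarith [sq_nonneg (x - a), sq_nonneg (x - b)]
  · intro hlt
    by_contra hcon
    push Not at hcon
    nlinarith

theorem continuous_levelSq (a b : ℝ) {L : ℝ → ℝ} (hL : Continuous L) :
    Continuous fun x => levelSq a b (L x) x := by
  unfold levelSq
  fun_prop

theorem continuous_levelPoint (a b : ℝ) {L : ℝ → ℝ} (hL : Continuous L) :
    Continuous fun x => levelPoint a b (L x) x := by
  have : (fun x => levelPoint a b (L x) x)
      = fun x : ℝ => (x : ℂ) + (√(levelSq a b (L x) x) : ℝ) * Complex.I := by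
    funext x
    exact (Complex.mk_eq_add_mul_I _ _)
  rw [this]
  have := continuous_levelSq a b hL
  fun_prop

theorem levelPoint_sub_ne_zero {L : ℝ} (hL : 0 < L) (a b x : ℝ) : levelPoint a b L x - a ≠ 0 := by
  intro h
  have hre := congrArg Complex.re h
  have him := congrArg Complex.im h
  simp only [levelPoint, Complex.sub_re, Complex.ofReal_re, Complex.zero_re, Complex.sub_im,
    Complex.ofReal_im, sub_zero, Complex.zero_im, Real.sqrt_eq_zero'] at hre him
  have := add_levelSq_pos hL a b x
  rw [hre] at this
  linarith

theorem norm_levelPoint_sub {L : ℝ} (a b x : ℝ) (hY : 0 ≤ levelSq a b L x) :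
    ‖levelPoint a b L x - a‖ ^ 2 = (x - a) ^ 2 + levelSq a b L x := by
  rw [← Complex.normSq_eq_norm_sq, Complex.normSq_apply]
  simp [levelPoint, Real.mul_self_sqrt hY, sq]

theorem norm_levelPoint_mul {L : ℝ} (hL : 0 < L) (a b x : ℝ) (hY : 0 ≤ levelSq a b L x) :
    ‖levelPoint a b L x - a‖ * ‖levelPoint a b L x - b‖ = L := by
  have h1 := norm_levelPoint_sub a b x hY
  have h2 : ‖levelPoint a b L x - b‖ ^ 2 = (x - b) ^ 2 + levelSq a b L x := by
    rw [levelPoint_comm, levelSq_comm]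
    rw [levelSq_comm] at hY
    exact norm_levelPoint_sub b a x hY
  have h := levelSq_mul a b L x
  rw [← h1, ← h2, ← mul_pow] at h
  exact (sq_eq_sq₀ (by positivity) hL.le).1 h

/-- On the branch cut `arg` takes the value `π`, its limit from above. This keeps the phase
continuous when `levelPoint` runs along the real axis to the left of `a` or `b`. -/
theorem continuousOn_arg_upper : ContinuousOn Complex.arg {z : ℂ | 0 ≤ z.im ∧ z ≠ 0} := by
  rintro z ⟨him, hz⟩
  by_cases hs : z ∈ Complex.slitPlane
  · exact (Complex.continuousAt_arg hs).continuousWithinAt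
  · rw [Complex.mem_slitPlane_iff] at hs
    push Not at hs
    have hre : z.re < 0 := lt_of_le_of_ne hs.1 fun h => hz (Complex.ext h hs.2)
    exact (Complex.continuousWithinAt_arg_of_re_neg_of_im_zero hre hs.2).mono fun w hw => hw.1

/-- The phase of `(z - a) (z - b) exp (z τ)`, unwound on the closed upper half plane. -/
noncomputable def charPhase (a b τ : ℝ) (z : ℂ) : ℝ :=
  Complex.arg (z - a) + Complex.arg (z - b) + τ * z.im

theorem continuous_charPhase_levelPoint (a b τ : ℝ) {L : ℝ → ℝ} (hL : Continuous L)
    (hpos : ∀ x, 0 < L x) : Continuous fun x => charPhase a b τ (levelPoint a b (L x) x) := by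
  have hc := continuous_levelPoint a b hL
  have key : ∀ c : ℝ, (∀ x, levelPoint a b (L x) x - c ≠ 0) →
      Continuous fun x => Complex.arg (levelPoint a b (L x) x - c) := by
    intro c hne
    refine continuousOn_arg_upper.comp_continuous (hc.sub continuous_const) fun x => ⟨?_, hne x⟩
    simp [levelPoint]
  unfold charPhase
  refine ((key a fun x => levelPoint_sub_ne_zero (hpos x) a b x).add (key b fun x => ?_)).add
    (continuous_const.mul (Complex.continuous_im.comp hc))
  rw [levelPoint_comm]
  exact levelPoint_sub_ne_zero (hpos x) b a x

theorem mul_eq_exp_charPhase (a b τ : ℝ) (z : ℂ) :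
    (z - a) * (z - b) = (‖z - a‖ * ‖z - b‖ * Real.exp (z.re * τ) : ℝ)
      * Complex.exp (charPhase a b τ z * Complex.I) * Complex.exp (-z * τ) := by
  conv_lhs => rw [← Complex.norm_mul_exp_arg_mul_I (z - a), ← Complex.norm_mul_exp_arg_mul_I (z - b)]
  have h : Complex.exp (charPhase a b τ z * Complex.I) * Complex.exp (-z * τ)
      * Complex.exp (z.re * τ) = Complex.exp (Complex.arg (z - a) * Complex.I)
        * Complex.exp (Complex.arg (z - b) * Complex.I) := by
    rw [← Complex.exp_add, ← Complex.exp_add, ← Complex.exp_add]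
    congr 1
    unfold charPhase
    push_cast
    linear_combination (τ : ℂ) * Complex.re_add_im z
  push_cast
  linear_combination (-(‖z - a‖ : ℂ) * ‖z - b‖) * h

theorem root_of_charPhase {a b K τ : ℝ} {z : ℂ}
    (hn : ‖z - a‖ * ‖z - b‖ = K * Real.exp (-(z.re * τ))) (hp : charPhase a b τ z = Real.pi) :
    (z - a) * (z - b) + K * Complex.exp (-z * τ) = 0 := by
  rw [mul_eq_exp_charPhase a b τ z, hn, hp, Complex.exp_pi_mul_I, mul_assoc K, ← Real.exp_add]
  simp

/-! ### Existence of roots in the right half plane -/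

theorem exists_real_root {a b k τ x₀ : ℝ} (hτ : 0 ≤ τ) (hx₀ : 0 ≤ x₀)
    (h : (x₀ - a) * (x₀ - b) - k * Real.exp (-x₀ * τ) ≤ 0) :
    ∃ x : ℝ, x₀ ≤ x ∧ (x - a) * (x - b) - k * Real.exp (-x * τ) = 0 := by
  -- Both factors are at least `|k| + 1` here, so their product beats the exponential term.
  set X := x₀ + |a| + |b| + |k| + 1 with hX
  have hle : x₀ ≤ X := by
    have := abs_nonneg a; have := abs_nonneg b; have := abs_nonneg k
    linarith
  have hcont : ContinuousOn (fun x : ℝ => (x - a) * (x - b) - k * Real.exp (-x * τ))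
      (Set.Icc x₀ X) := by fun_prop
  have hXpos : 0 ≤ (X - a) * (X - b) - k * Real.exp (-X * τ) := by
    have he : Real.exp (-X * τ) ≤ 1 := Real.exp_le_one_iff.2 (by nlinarith)
    have he0 := Real.exp_pos (-X * τ)
    have h1 : |k| + 1 ≤ X - a := by linarith [le_abs_self a, abs_nonneg b]
    have h2 : |k| + 1 ≤ X - b := by linarith [le_abs_self b, abs_nonneg a]
    have h3 : k * Real.exp (-X * τ) ≤ |k| := by
      have := mul_le_mul (le_abs_self k) he he0.le (abs_nonneg k)
      linarith
    nlinarith [abs_nonneg k]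
  obtain ⟨x, hx, hx0⟩ := intermediate_value_Icc hle hcont ⟨h, hXpos⟩
  exact ⟨x, hx.1, hx0⟩

theorem complex_root_of_real_root {a b k τ x : ℝ}
    (h : (x - a) * (x - b) - k * Real.exp (-x * τ) = 0) :
    ((x : ℂ) - a) * (x - b) - k * Complex.exp (-x * τ) = 0 := by
  exact_mod_cast congrArg (fun r : ℝ => (r : ℂ)) h

theorem exists_root_of_charPhase {a b K τ : ℝ} (hK : 0 < K) (hτ : 0 ≤ τ)
    (h0 : Real.pi < charPhase a b τ (levelPoint a b K 0)) :
    ∃ z : ℂ, 0 < z.re ∧ (z - a) * (z - b) + K * Complex.exp (-z * τ) = 0 := by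
  -- The level varies with `x`: it is the modulus that the root equation imposes at real part `x`.
  set L : ℝ → ℝ := fun x => K * Real.exp (-(x * τ)) with hLdef
  have hLc : Continuous L := by fun_prop
  have hLpos : ∀ x, 0 < L x := fun x => by positivity
  have hL0 : L 0 = K := by simp [hLdef]
  have hcont := continuous_charPhase_levelPoint a b τ hLc hLpos
  set X := |a| + |b| + K + 1 with hX
  have hX0 : 0 ≤ X := by positivity
  have hXa : K + 1 ≤ X - a := by linarith [le_abs_self a, abs_nonneg b]
  have hXb : K + 1 ≤ X - b := by linarith [le_abs_self b, abs_nonneg a]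
  have him0 : ∀ x, levelSq a b (L x) x < 0 → levelPoint a b (L x) x = (x : ℂ) := by
    intro x hx
    unfold levelPoint
    rw [Real.sqrt_eq_zero_of_nonpos hx.le]
    rfl
  have hXneg : levelSq a b (L X) X < 0 := by
    rw [levelSq_neg_iff (hLpos X), abs_of_pos (mul_pos (by linarith) (by linarith))]
    have : L X ≤ K := by
      have : Real.exp (-(X * τ)) ≤ 1 := Real.exp_le_one_iff.2 (by nlinarith)
      simp only [hLdef]; nlinarith
    nlinarith
  have hXphase : charPhase a b τ (levelPoint a b (L X) X) = 0 := by
    rw [him0 X hXneg, charPhase, Complex.ofReal_im, ← Complex.ofReal_sub, ← Complex.ofReal_sub,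
      Complex.arg_ofReal_of_nonneg (by linarith), Complex.arg_ofReal_of_nonneg (by linarith)]
    ring
  obtain ⟨x, hx, hxp⟩ := intermediate_value_Icc' hX0 hcont.continuousOn
    (show Real.pi ∈ Set.Icc _ _ from ⟨by rw [hXphase]; exact Real.pi_pos.le, by rw [hL0]; exact h0.le⟩)
  have hxpos : 0 < x := by
    refine lt_of_le_of_ne hx.1 fun h => ?_
    rw [← h] at hxp
    simp only [hL0] at hxp
    linarith
  -- The phase may reach `π` on a real stretch of the path that is off the level curve. Exactly one
  -- of `x - a`, `x - b` is then negative, so the characteristic function is negative at `x` and has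
  -- a real root further right.
  rcases lt_or_ge (levelSq a b (L x) x) 0 with hY | hY
  · simp only [him0 x hY, charPhase, Complex.ofReal_im, ← Complex.ofReal_sub, mul_zero,
      add_zero] at hxp
    have hprod : (x - a) * (x - b) < 0 := by
      have hpi := Real.pi_pos
      rcases lt_or_ge (x - a) 0 with h1 | h1 <;> rcases lt_or_ge (x - b) 0 with h2 | h2
      · rw [Complex.arg_ofReal_of_neg h1, Complex.arg_ofReal_of_neg h2] at hxp
        linarith
      · rcases h2.eq_or_lt with h3 | h3
        · rw [levelSq_neg_iff (hLpos x), ← h3, mul_zero, abs_zero] at hY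
          linarith [hLpos x]
        · nlinarith
      · rcases h1.eq_or_lt with h3 | h3
        · rw [levelSq_neg_iff (hLpos x), ← h3, zero_mul, abs_zero] at hY
          linarith [hLpos x]
        · nlinarith
      · rw [Complex.arg_ofReal_of_nonneg h1, Complex.arg_ofReal_of_nonneg h2] at hxp
        linarith
    rw [levelSq_neg_iff (hLpos x), abs_of_neg hprod] at hY
    obtain ⟨x', hx', hr⟩ := exists_real_root (a := a) (b := b) (k := -K) hτ hxpos.le
      (by simp only [hLdef] at hY; rw [neg_mul x]; linarith)
    refine ⟨x', by simpa using hxpos.trans_le hx', ?_⟩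
    have := complex_root_of_real_root hr
    push_cast at this
    linear_combination this
  · exact ⟨levelPoint a b (L x) x, hxpos,
      root_of_charPhase (norm_levelPoint_mul (hLpos x) a b x hY) hxp⟩

/-! ### The imaginary axis, the critical delay and the absence of roots below it -/

/-- On the positive imaginary axis the two arguments add up to less than `π` exactly when
`a + b < 0`. -/
theorem sin_arg_add_arg {a b y : ℝ} (hy : 0 < y) :
    ‖(⟨0, y⟩ : ℂ) - a‖ * ‖(⟨0, y⟩ : ℂ) - b‖
      * Real.sin (Complex.arg (⟨0, y⟩ - a) + Complex.arg (⟨0, y⟩ - b)) = -(a + b) * y := by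
  have ha : (⟨0, y⟩ : ℂ) - a ≠ 0 := fun h => hy.ne' (by simpa using congrArg Complex.im h)
  have hb : (⟨0, y⟩ : ℂ) - b ≠ 0 := fun h => hy.ne' (by simpa using congrArg Complex.im h)
  have h1 := norm_pos_iff.2 ha
  have h2 := norm_pos_iff.2 hb
  rw [Real.sin_add, Complex.sin_arg, Complex.sin_arg, Complex.cos_arg ha, Complex.cos_arg hb]
  field_simp
  simp
  ring

theorem arg_axis_mem {a y : ℝ} (hy : 0 < y) :
    0 < Complex.arg ((⟨0, y⟩ : ℂ) - a) ∧ Complex.arg ((⟨0, y⟩ : ℂ) - a) < Real.pi := by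
  constructor
  · refine lt_of_le_of_ne (Complex.arg_nonneg_iff.2 (by simpa using hy.le)) fun h => ?_
    have := (Complex.arg_eq_zero_iff.1 h.symm).2
    simp at this
    exact hy.ne' this
  · refine Complex.arg_lt_pi_iff.2 (Or.inr ?_)
    simpa using hy.ne'

theorem pi_lt_arg_add_arg {a b y : ℝ} (hy : 0 < y) (hab : 0 < a + b) :
    Real.pi < Complex.arg (⟨0, y⟩ - a) + Complex.arg (⟨0, y⟩ - b) := by
  have h := sin_arg_add_arg (a := a) (b := b) hy
  by_contra hcon
  push Not at hcon
  have hs := Real.sin_nonneg_of_nonneg_of_le_pi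
    (add_pos (arg_axis_mem (a := a) hy).1 (arg_axis_mem (a := b) hy).1).le hcon
  have := mul_nonneg (mul_nonneg (norm_nonneg ((⟨0, y⟩ : ℂ) - a)) (norm_nonneg ((⟨0, y⟩ : ℂ) - b))) hs
  nlinarith

theorem arg_add_arg_lt_pi {a b y : ℝ} (hy : 0 < y) (hab : a + b < 0) :
    Complex.arg (⟨0, y⟩ - a) + Complex.arg (⟨0, y⟩ - b) < Real.pi := by
  have h := sin_arg_add_arg (a := a) (b := b) hy
  by_contra hcon
  push Not at hcon
  have h1 := (arg_axis_mem (a := a) hy).2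
  have h2 := (arg_axis_mem (a := b) hy).2
  set s := Complex.arg ((⟨0, y⟩ : ℂ) - a) + Complex.arg (⟨0, y⟩ - b)
  have hs : Real.sin s ≤ 0 := by
    have := Real.sin_nonneg_of_nonneg_of_le_pi (x := s - Real.pi) (by linarith) (by linarith)
    rw [Real.sin_sub_pi] at this
    linarith
  have := mul_nonneg (mul_nonneg (norm_nonneg ((⟨0, y⟩ : ℂ) - a)) (norm_nonneg ((⟨0, y⟩ : ℂ) - b)))
    (neg_nonneg.2 hs)
  nlinarith

/-- Persistence of zeros of entire functions under continuous perturbation. -/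
theorem eventually_exists_zero_of_continuous {f : ℝ → ℂ → ℂ} (hf : Continuous fun p : ℝ × ℂ => f p.1 p.2)
    (hd : ∀ τ, Differentiable ℂ (f τ)) {τ₀ : ℝ} {z₀ z₁ : ℂ} (h0 : f τ₀ z₀ = 0)
    (h1 : f τ₀ z₁ ≠ 0) {ρ : ℝ} (hρ : 0 < ρ) :
    ∀ᶠ τ in 𝓝 τ₀, ∃ z ∈ Metric.closedBall z₀ ρ, f τ z = 0 := by
  have han : ∀ τ, AnalyticOnNhd ℂ (f τ) Set.univ := fun τ z _ => (hd τ).analyticAt z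
  -- The point `z₁` excludes the zero function, so `z₀` is an isolated zero.
  have hiso : ∀ᶠ z in 𝓝[≠] z₀, f τ₀ z ≠ 0 := by
    rcases ((han τ₀) z₀ trivial).eventually_eq_zero_or_eventually_ne_zero with h | h
    · exact absurd (congrFun ((han τ₀).eq_of_eventuallyEq (g := fun _ => 0)
        (fun z _ => analyticAt_const) h) z₁) h1
    · exact h
  rw [eventually_nhdsWithin_iff, Metric.eventually_nhds_iff_ball] at hiso
  obtain ⟨ε, hε, hiso⟩ := hiso
  obtain ⟨r, hr0, hrε, hrρ⟩ : ∃ r, 0 < r ∧ r < ε ∧ r ≤ ρ :=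
    ⟨min (ε / 2) ρ, by positivity, (min_le_left _ _).trans_lt (by linarith), min_le_right _ _⟩
  obtain ⟨w, hw, hmin⟩ := (isCompact_sphere z₀ r).exists_isMinOn
    (NormedSpace.sphere_nonempty.2 hr0.le) ((hd τ₀).continuous.norm.continuousOn)
  set m := ‖f τ₀ w‖ with hm
  have hm0 : 0 < m := by
    refine norm_pos_iff.2 (hiso w ?_ ?_)
    · rw [Metric.mem_ball, Metric.mem_sphere.1 hw]; exact hrε
    · rintro rfl
      simp at hw
      exact hr0.ne hw
  -- Two errors of `m / 4` leave a variation of at least `m / 2` on the circle. The quantitative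
  -- open mapping theorem then covers a ball of radius `m / 4` about `f τ z₀`, which contains `0`.
  have hclose : ∀ᶠ τ in 𝓝 τ₀, ∀ z ∈ Metric.closedBall z₀ r, ‖f τ z - f τ₀ z‖ < m / 4 := by
    have hc : Continuous fun p : ℝ × ℂ => ‖f p.1 p.2 - f τ₀ p.2‖ := by
      have := (hd τ₀).continuous
      fun_prop
    refine (isCompact_closedBall z₀ r).eventually_forall_of_forall_eventually fun z _ => ?_
    refine hc.continuousAt.eventually_lt continuousAt_const ?_
    simpa using hm0
  filter_upwards [hclose] with τ hτ
  have hz₀ := hτ z₀ (Metric.mem_closedBall_self hr0.le)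
  rw [h0, sub_zero] at hz₀
  have hsph : ∀ z ∈ Metric.sphere z₀ r, m / 2 ≤ ‖f τ z - f τ z₀‖ := by
    intro z hz
    have h2 := hτ z (Metric.sphere_subset_closedBall hz)
    have h3 : m ≤ ‖f τ₀ z‖ := hmin hz
    have h4 : ‖f τ₀ z‖ ≤ ‖f τ z - f τ z₀‖ + ‖f τ z - f τ₀ z‖ + ‖f τ z₀‖ := by
      have e : f τ₀ z = (f τ z - f τ z₀) - (f τ z - f τ₀ z) + f τ z₀ := by ring
      calc ‖f τ₀ z‖ = ‖(f τ z - f τ z₀) - (f τ z - f τ₀ z) + f τ z₀‖ := by rw [← e]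
        _ ≤ _ := (norm_add_le _ _).trans (by gcongr; exact norm_sub_le _ _)
    linarith
  have hfreq : ∃ᶠ z in 𝓝 z₀, f τ z ≠ f τ z₀ := by
    intro h
    have h' : f τ =ᶠ[𝓝 z₀] fun _ => f τ z₀ := h.mono fun z hz => not_not.1 hz
    have := congrFun ((han τ).eq_of_eventuallyEq (fun z _ => analyticAt_const) h') w
    have h5 := hsph w hw
    rw [this, sub_self, norm_zero] at h5
    linarith
  obtain ⟨z, hz, hfz⟩ := (hd τ).diffContOnCl.ball_subset_image_closedBall hr0 hsph hfreq
    (show (0 : ℂ) ∈ Metric.ball (f τ z₀) (m / 2 / 2) by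
      rw [Metric.mem_ball, dist_zero_left]; linarith)
  exact ⟨z, Metric.closedBall_subset_closedBall hrρ hz, hfz⟩

/-- The product of the two moduli is strictly increasing in `y ^ 2`, so roots on the axis can occur
at one frequency only, the same for all delays. -/
theorem levelSq_eq_of_norm_mul {a b K y : ℝ} (hK : 0 < K)
    (h : ‖(⟨0, y⟩ : ℂ) - a‖ * ‖(⟨0, y⟩ : ℂ) - b‖ = K) : y ^ 2 = levelSq a b K 0 := by
  have hn : ∀ c : ℝ, ‖(⟨0, y⟩ : ℂ) - c‖ ^ 2 = c ^ 2 + y ^ 2 := by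
    intro c
    rw [← Complex.normSq_eq_norm_sq, Complex.normSq_apply]
    simp [sq]
  have h1 := levelSq_mul a b K 0
  have h2 := add_levelSq_pos hK a b 0
  have h3 := add_levelSq_pos' hK a b 0
  rw [← h, mul_pow, hn, hn] at h1
  rw [h] at h1
  simp only [zero_sub, neg_sq] at h1 h2 h3
  set Y := levelSq a b K 0
  have h4 : (y ^ 2 - Y) * (a ^ 2 + y ^ 2 + (b ^ 2 + Y)) = 0 := by linear_combination -h1
  rcases mul_eq_zero.1 h4 with h5 | h5
  · linarith
  · nlinarith [sq_nonneg a, sq_nonneg y]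

/-- The delay at which a root reaches the imaginary axis. -/
noncomputable def criticalDelay (a b K : ℝ) : ℝ :=
  (Real.pi - (Complex.arg (levelPoint a b K 0 - a) + Complex.arg (levelPoint a b K 0 - b)))
    / (levelPoint a b K 0).im

theorem levelPoint_zero_im_pos {a b K : ℝ} (hK : |a * b| < K) : 0 < (levelPoint a b K 0).im := by
  have h : 0 < levelSq a b K 0 := by
    rw [levelSq_pos_iff ((abs_nonneg _).trans_lt hK)]
    simpa using hK
  exact Real.sqrt_pos.2 h

theorem criticalDelay_pos {a b K : ℝ} (hK : |a * b| < K) (hab : a + b < 0) :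
    0 < criticalDelay a b K :=
  div_pos (sub_pos.2 (arg_add_arg_lt_pi (levelPoint_zero_im_pos hK) hab))
    (levelPoint_zero_im_pos hK)

theorem charPhase_lt_pi_iff {a b K τ : ℝ} (hK : |a * b| < K) :
    charPhase a b τ (levelPoint a b K 0) < Real.pi ↔ τ < criticalDelay a b K := by
  rw [criticalDelay, lt_div_iff₀ (levelPoint_zero_im_pos hK), charPhase]
  constructor <;> intro h <;> linarith

theorem pi_lt_charPhase_iff {a b K τ : ℝ} (hK : |a * b| < K) :
    Real.pi < charPhase a b τ (levelPoint a b K 0) ↔ criticalDelay a b K < τ := by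
  rw [criticalDelay, div_lt_iff₀ (levelPoint_zero_im_pos hK), charPhase]
  constructor <;> intro h <;> linarith

theorem conj_root {a b K τ : ℝ} {z : ℂ} (h : (z - a) * (z - b) + K * Complex.exp (-z * τ) = 0) :
    ((starRingEnd ℂ) z - a) * ((starRingEnd ℂ) z - b)
      + K * Complex.exp (-(starRingEnd ℂ) z * τ) = 0 := by
  have := congrArg (starRingEnd ℂ) h
  simpa [← Complex.exp_conj] using this

/-- The modulus pins an upper root to `levelPoint a b K 0`, where the phase lies strictly between
`0` and `π`, so its exponential is not `-1`. Conjugation handles the lower half, and `ab + K > 0`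
excludes `z = 0`. -/
theorem no_root_on_axis {a b K τ : ℝ} (hK : |a * b| < K) (hτ : 0 ≤ τ)
    (hτc : τ < criticalDelay a b K) (z : ℂ) (hz : z.re = 0) :
    (z - a) * (z - b) + K * Complex.exp (-z * τ) ≠ 0 := by
  have hK0 := (abs_nonneg _).trans_lt hK
  have hupper : ∀ z : ℂ, z.re = 0 → 0 < z.im →
      (z - a) * (z - b) + K * Complex.exp (-z * τ) ≠ 0 := by
    intro z hz hy h
    obtain ⟨x, y⟩ := z
    simp only at hz hy
    subst hz
    have hn : ‖(⟨0, y⟩ : ℂ) - a‖ * ‖(⟨0, y⟩ : ℂ) - b‖ = K := by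
      rw [← norm_mul, eq_neg_of_add_eq_zero_left h, norm_neg, norm_mul, Complex.norm_exp]
      simp [hK0.le]
    have hy2 := levelSq_eq_of_norm_mul hK0 hn
    have hlp : levelPoint a b K 0 = ⟨0, y⟩ := by
      rw [levelPoint, ← hy2, Real.sqrt_sq hy.le]
    have hlt := (charPhase_lt_pi_iff hK).2 hτc
    rw [hlp] at hlt
    have hpos : 0 < charPhase a b τ ⟨0, y⟩ := by
      have := mul_nonneg hτ hy.le
      have h1 := (arg_axis_mem (a := a) hy).1
      have h2 := (arg_axis_mem (a := b) hy).1
      simp only [charPhase]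
      linarith
    rw [mul_eq_exp_charPhase a b τ, hn] at h
    have h' : (K * Complex.exp (-(⟨0, y⟩ : ℂ) * τ))
        * (Complex.exp (charPhase a b τ ⟨0, y⟩ * Complex.I) + 1) = 0 := by
      simp only [zero_mul, Real.exp_zero, mul_one] at h
      linear_combination h
    have h2 := (mul_eq_zero.1 h').resolve_left
      (mul_ne_zero (by exact_mod_cast hK0.ne') (Complex.exp_ne_zero _))
    have h3 := congrArg Complex.im h2
    rw [Complex.add_im, Complex.exp_ofReal_mul_I_im] at h3
    simp only [Complex.one_im, add_zero, Complex.zero_im] at h3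
    exact (Real.sin_pos_of_pos_of_lt_pi hpos hlt).ne' h3
  rcases lt_trichotomy z.im 0 with h | h | h
  · intro hr
    exact hupper _ (by simpa using hz) (by simpa using h) (conj_root hr)
  · intro hr
    have : z = 0 := Complex.ext hz h
    subst this
    have h0 : a * b + K = 0 := by
      have := congrArg Complex.re hr
      simpa using this
    linarith [neg_abs_le (a * b)]
  · exact hupper z hz h

theorem norm_le_of_root {a b K τ : ℝ} (hK : 0 < K) (hτ : 0 ≤ τ) {z : ℂ} (hz : 0 ≤ z.re)
    (h : (z - a) * (z - b) + K * Complex.exp (-z * τ) = 0) : ‖z‖ ≤ |a| + |b| + K + 1 := by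
  by_contra hcon
  push Not at hcon
  have hn : ‖z - a‖ * ‖z - b‖ ≤ K := by
    rw [← norm_mul, eq_neg_of_add_eq_zero_left h, norm_neg, norm_mul, Complex.norm_exp]
    have : Real.exp (-z * τ).re ≤ 1 := by
      rw [Real.exp_le_one_iff, Complex.re_mul_ofReal, Complex.neg_re]
      nlinarith
    rw [Complex.norm_real, Real.norm_of_nonneg hK.le]
    nlinarith
  have h1 := norm_sub_norm_le z (a : ℂ)
  have h2 := norm_sub_norm_le z (b : ℂ)
  rw [Complex.norm_real, Real.norm_eq_abs] at h1 h2
  have := abs_nonneg a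
  have := abs_nonneg b
  nlinarith

theorem no_root_of_zero_delay {a b K : ℝ} (hK : |a * b| < K) (hab : a + b < 0) {z : ℂ}
    (hz : 0 ≤ z.re) : (z - a) * (z - b) + K ≠ 0 := by
  intro h
  have hre := congrArg Complex.re h
  have him := congrArg Complex.im h
  simp at hre him
  have h1 : z.im * (2 * z.re - (a + b)) = 0 := by linear_combination him
  have h2 : z.im = 0 := (mul_eq_zero.1 h1).resolve_right (by linarith)
  rw [h2] at hre
  nlinarith [neg_abs_le (a * b)]

/-- Roots in the closed right half plane are bounded, so there would be a least delay admitting one.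
It is not `0`, and the root is off the axis; by persistence of zeros a slightly smaller delay then
has such a root too. -/
theorem no_root_of_lt_criticalDelay {a b K τ : ℝ} (hK : |a * b| < K) (hab : a + b < 0)
    (hτ : 0 ≤ τ) (hτc : τ < criticalDelay a b K) {z : ℂ} (hz : 0 ≤ z.re) :
    (z - a) * (z - b) + K * Complex.exp (-z * τ) ≠ 0 := by
  intro hroot
  have hK0 := (abs_nonneg _).trans_lt hK
  set f : ℝ → ℂ → ℂ := fun τ z => (z - a) * (z - b) + K * Complex.exp (-z * τ) with hf
  have hfc : Continuous fun p : ℝ × ℂ => f p.1 p.2 := by fun_prop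
  set S : Set (ℝ × ℂ) := (Set.Icc 0 τ ×ˢ Metric.closedBall 0 (|a| + |b| + K + 1))
    ∩ {p | 0 ≤ p.2.re ∧ f p.1 p.2 = 0} with hS
  have hScl : IsClosed {p : ℝ × ℂ | 0 ≤ p.2.re ∧ f p.1 p.2 = 0} :=
    (isClosed_le continuous_const (Complex.continuous_re.comp continuous_snd)).inter
      (isClosed_eq hfc continuous_const)
  have hScpt : IsCompact S := (isCompact_Icc.prod (isCompact_closedBall _ _)).inter_right hScl
  have hmem : ∀ s ∈ Set.Icc 0 τ, ∀ w : ℂ, 0 ≤ w.re → f s w = 0 → s ∈ Prod.fst '' S := by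
    intro s hs w hw hfw
    exact ⟨(s, w), ⟨⟨hs, mem_closedBall_zero_iff.2 (norm_le_of_root hK0 hs.1 hw hfw)⟩, hw, hfw⟩, rfl⟩
  obtain ⟨s, ⟨⟨s', w⟩, ⟨⟨hs, -⟩, hw, hfw⟩, rfl⟩, hleast⟩ :=
    (hScpt.image continuous_fst).exists_isLeast ⟨τ, hmem τ ⟨hτ, le_rfl⟩ z hz hroot⟩
  simp only at hs hw hfw hleast
  have hs0 : 0 < s' := by
    refine lt_of_le_of_ne hs.1 fun h => no_root_of_zero_delay hK hab hw ?_
    rw [← h] at hfw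
    simpa [hf] using hfw
  have hw0 : 0 < w.re := by
    refine lt_of_le_of_ne hw fun h => ?_
    exact no_root_on_axis hK hs.1 (hs.2.trans_lt hτc) w h.symm hfw
  have hne : f s' 0 ≠ 0 := no_root_on_axis hK hs.1 (hs.2.trans_lt hτc) 0 rfl
  have hev := eventually_exists_zero_of_continuous hfc
    (fun τ => by simp only [hf]; fun_prop) hfw hne hw0
  have hev' : ∀ᶠ t in 𝓝[<] s', 0 ≤ t ∧ t < s' :=
    (Ico_mem_nhdsLT hs0)
  obtain ⟨t, ⟨v, hv, hfv⟩, ht⟩ := ((hev.filter_mono nhdsWithin_le_nhds).and hev').exists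
  have hvre : 0 ≤ v.re := by
    have h1 := (Complex.abs_re_le_norm (v - w)).trans (mem_closedBall_iff_norm.1 hv)
    rw [Complex.sub_re] at h1
    linarith [neg_abs_le (v.re - w.re)]
  have := hleast (hmem t ⟨ht.1, ht.2.le.trans hs.2⟩ v hvre hfv)
  linarith [ht.2]

/-! ### Laplace inversion: decay when there are no roots -/

open MeasureTheory in
/-- Contour shift between two vertical lines for a quadratically decaying function. -/
theorem integral_vertical_eq {g : ℂ → ℂ} {c C : ℝ} (hc : 0 ≤ c)
    (hd : ∀ z : ℂ, 0 ≤ z.re → DifferentiableAt ℂ g z)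
    (hb : ∀ z : ℂ, 0 ≤ z.re → z.re ≤ c → ‖g z‖ ≤ C * (1 + z.im ^ 2)⁻¹) :
    ∫ y : ℝ, g (c + y * Complex.I) = ∫ y : ℝ, g (y * Complex.I) := by
  have hint : ∀ a : ℝ, 0 ≤ a → a ≤ c → Integrable fun y : ℝ => g (a + y * Complex.I) := by
    intro a ha hac
    have hcont : Continuous fun y : ℝ => g (a + y * Complex.I) := by
      refine continuous_iff_continuousAt.2 fun y => ?_
      have h1 := (hd (a + y * Complex.I) (by simpa using ha)).continuousAt
      exact ContinuousAt.comp (f := fun y : ℝ => (a + y * Complex.I : ℂ)) h1 (by fun_prop)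
    refine (integrable_inv_one_add_sq.const_mul C).mono' hcont.aestronglyMeasurable
      (Eventually.of_forall fun y => ?_)
    simpa using hb (a + y * Complex.I) (by simpa using ha) (by simpa using hac)
  have hlim : ∀ a : ℝ, 0 ≤ a → a ≤ c → Tendsto (fun T : ℝ => ∫ y in (-T)..T, g (a + y * Complex.I))
      atTop (𝓝 (∫ y : ℝ, g (a + y * Complex.I))) := fun a ha hac =>
    intervalIntegral_tendsto_integral (hint a ha hac) tendsto_neg_atTop_atBot tendsto_id
  have hside : ∀ s : ℝ → ℝ, (∀ T, s T ^ 2 = T ^ 2) →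
      Tendsto (fun T : ℝ => ∫ x in (0 : ℝ)..c, g (x + s T * Complex.I)) atTop (𝓝 0) := by
    intro s hs
    have h0 : Tendsto (fun T : ℝ => C * (1 + T ^ 2)⁻¹ * |c - 0|) atTop (𝓝 0) := by
      have : Tendsto (fun T : ℝ => 1 + T ^ 2) atTop atTop :=
        tendsto_atTop_add_const_left _ _ (tendsto_pow_atTop two_ne_zero)
      simpa using (this.inv_tendsto_atTop.const_mul C).mul_const (|c - 0|)
    refine squeeze_zero_norm (fun T => ?_) h0
    refine intervalIntegral.norm_integral_le_of_norm_le_const fun x hx => ?_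
    rw [Set.uIoc_of_le hc] at hx
    have := hb (x + s T * Complex.I) (by simpa using hx.1.le) (by simpa using hx.2)
    simpa [hs T] using this
  have hrect : ∀ T : ℝ, ((∫ x in (0 : ℝ)..c, g (x + (-T : ℝ) * Complex.I))
      - ∫ x in (0 : ℝ)..c, g (x + T * Complex.I))
      + Complex.I * (∫ y in (-T)..T, g (c + y * Complex.I))
      - Complex.I * (∫ y in (-T)..T, g ((0 : ℝ) + y * Complex.I)) = 0 := by
    intro T
    have := Complex.integral_boundary_rect_eq_zero_of_differentiableOn g ⟨0, -T⟩ ⟨c, T⟩ (by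
      intro z hz
      have h1 := (Complex.mem_reProdIm.1 hz).1
      simp only [Set.uIcc_of_le hc] at h1
      exact (hd z h1.1).differentiableWithinAt)
    simpa only [smul_eq_mul] using this
  have hl := (((hside (fun T => -T) (fun T => neg_sq T)).sub (hside (fun T => T) (fun _ => rfl))).add
    ((hlim c hc le_rfl).const_mul Complex.I)).sub ((hlim 0 le_rfl hc).const_mul Complex.I)
  have h0 := tendsto_nhds_unique (hl.congr hrect) tendsto_const_nhds
  have h1 : Complex.I * ((∫ y : ℝ, g (c + y * Complex.I))
      - ∫ y : ℝ, g ((0 : ℝ) + y * Complex.I)) = 0 := by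
    linear_combination h0
  have h2 := sub_eq_zero.1 ((mul_eq_zero.1 h1).resolve_left Complex.I_ne_zero)
  simpa using h2

/-- Exponential growth bound for solutions of `x'' = p x' - q x + k x(t - τ)`. -/
theorem delay_exp_bound {p q k τ : ℝ} (hτ : 0 ≤ τ) {x v : ℝ → ℝ} (hx : Continuous x)
    (hdx : ∀ t, 0 ≤ t → HasDerivWithinAt x (v t) (Set.Ici 0) t)
    (hdv : ∀ t, 0 ≤ t → HasDerivWithinAt v (p * v t - q * x t + k * x (t - τ)) (Set.Ici 0) t) :
    ∃ C M : ℝ, 0 < M ∧ (∀ t, -τ ≤ t → |x t| ≤ C * Real.exp (M * t)) ∧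
      ∀ t, 0 ≤ t → |v t| ≤ C * Real.exp (M * t) := by
  set M := 2 + 2 * |p| + |q| + k ^ 2 with hM
  have hM0 : 0 < M := by positivity
  -- The derivative of the integral supplies `-x (t - τ) ^ 2`, which absorbs the delayed term after
  -- Young's inequality, leaving `E' ≤ M E`.
  set E : ℝ → ℝ := fun t => x t ^ 2 + v t ^ 2 + ∫ s in (t - τ)..t, x s ^ 2 with hE
  have hx2 : Continuous fun s => x s ^ 2 := hx.pow 2
  have hInn : ∀ t, 0 ≤ ∫ s in (t - τ)..t, x s ^ 2 := fun t =>
    intervalIntegral.integral_nonneg (by linarith) fun s _ => sq_nonneg _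
  have hdI : ∀ t, HasDerivAt (fun t => ∫ s in (t - τ)..t, x s ^ 2) (x t ^ 2 - x (t - τ) ^ 2) t := by
    intro t
    have hi : ∀ a b : ℝ, IntervalIntegrable (fun s => x s ^ 2) MeasureTheory.volume a b :=
      fun a b => hx2.intervalIntegrable a b
    have h1 : ∀ t, HasDerivAt (fun t => ∫ s in (0 : ℝ)..t, x s ^ 2) (x t ^ 2) t := fun t =>
      intervalIntegral.integral_hasDerivAt_right (hi _ _)
        hx2.aestronglyMeasurable.stronglyMeasurableAtFilter hx2.continuousAt
    have h2 := (h1 t).sub ((h1 (t - τ)).comp_sub_const t τ)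
    refine h2.congr_of_eventuallyEq (Eventually.of_forall fun t => ?_)
    exact (intervalIntegral.integral_interval_sub_left (hi _ _) (hi _ _)).symm
  set E' : ℝ → ℝ := fun t => 2 * x t * v t + 2 * v t * (p * v t - q * x t + k * x (t - τ))
    + (x t ^ 2 - x (t - τ) ^ 2) with hE'
  have hdE : ∀ t, 0 ≤ t → HasDerivWithinAt E (E' t) (Set.Ici 0) t := by
    intro t ht
    refine ((((hdx t ht).pow 2).add ((hdv t ht).pow 2)).add
      (hdI t).hasDerivWithinAt).congr_deriv ?_
    simp only [hE']
    push_cast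
    ring
  have hEM : ∀ t, E' t ≤ M * E t := by
    intro t
    have h1 : M * (x t ^ 2 + v t ^ 2) ≤ M * E t :=
      mul_le_mul_of_nonneg_left (by simp only [hE]; linarith [hInn t]) hM0.le
    refine le_trans ?_ h1
    simp only [hE', hM]
    have e1 : 2 * p * v t ^ 2 ≤ 2 * |p| * v t ^ 2 := by
      have := mul_le_mul_of_nonneg_right (le_abs_self p) (sq_nonneg (v t))
      linarith
    have e2 : -(2 * q * (x t * v t)) ≤ |q| * (x t ^ 2 + v t ^ 2) := by
      rcases abs_cases q with ⟨h, h'⟩ | ⟨h, h'⟩ <;> rw [h] <;>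
        nlinarith [sq_nonneg (x t + v t), sq_nonneg (x t - v t)]
    have e3 : 2 * k * (v t * x (t - τ)) ≤ k ^ 2 * v t ^ 2 + x (t - τ) ^ 2 := by
      nlinarith [sq_nonneg (k * v t - x (t - τ))]
    have e4 : 2 * (x t * v t) ≤ x t ^ 2 + v t ^ 2 := by nlinarith [sq_nonneg (x t - v t)]
    have e5 : 0 ≤ |p| * x t ^ 2 := by positivity
    have e6 : 0 ≤ k ^ 2 * x t ^ 2 := by positivity
    nlinarith
  have hanti : AntitoneOn (fun t => E t * Real.exp (-(M * t))) (Set.Ici 0) := by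
    have hexp : ∀ t, HasDerivAt (fun t => Real.exp (-(M * t))) (Real.exp (-(M * t)) * -M) t := by
      intro t
      exact (((hasDerivAt_id t).const_mul M).neg.exp).congr_deriv (by simp)
    have hd : ∀ t, 0 ≤ t → HasDerivWithinAt (fun t => E t * Real.exp (-(M * t)))
        (E' t * Real.exp (-(M * t)) + E t * (Real.exp (-(M * t)) * -M)) (Set.Ici 0) t :=
      fun t ht => (hdE t ht).mul (hexp t).hasDerivWithinAt
    refine antitoneOn_of_hasDerivWithinAt_nonpos (convex_Ici 0)
      (fun t ht => (hd t ht).continuousWithinAt)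
      (fun t ht => (hd t (interior_subset ht)).mono interior_subset) fun t _ => ?_
    have := mul_le_mul_of_nonneg_right (hEM t) (Real.exp_pos (-(M * t))).le
    nlinarith
  have hEb : ∀ t, 0 ≤ t → E t ≤ E 0 * Real.exp (M * t) := by
    intro t ht
    have := hanti (Set.self_mem_Ici) ht ht
    simp only [mul_zero, neg_zero, Real.exp_zero, mul_one] at this
    rw [Real.exp_neg, ← div_eq_mul_inv, div_le_iff₀ (Real.exp_pos _)] at this
    exact this
  have hE0 : 0 ≤ E 0 := by
    have := hInn 0
    simp only [hE]
    positivity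
  have hsq : ∀ (u t : ℝ), 0 ≤ t → u ^ 2 ≤ E t → |u| ≤ √(E 0) * Real.exp (M * t) := by
    intro u t ht hu
    refine abs_le_of_sq_le_sq ?_ (by positivity)
    have h1 : 1 ≤ Real.exp (M * t) := Real.one_le_exp (by positivity)
    rw [mul_pow, Real.sq_sqrt hE0]
    have := hEb t ht
    nlinarith [mul_nonneg hE0 (Real.exp_pos (M * t)).le]
  obtain ⟨B, hB⟩ := (isCompact_Icc (a := -τ) (b := 0)).exists_bound_of_continuousOn hx.continuousOn
  have hB0 : 0 ≤ B := (norm_nonneg _).trans (hB 0 ⟨by linarith, le_rfl⟩)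
  have hBe : 0 ≤ B * Real.exp (M * τ) := by positivity
  -- The second summand covers the history, where `exp (M * t)` may be as small as `exp (-M * τ)`.
  refine ⟨√(E 0) + B * Real.exp (M * τ), M, hM0, fun t ht => ?_, fun t ht => ?_⟩
  · rcases le_total 0 t with h | h
    · have := hsq (x t) t h (by simp only [hE]; nlinarith [hInn t, sq_nonneg (v t)])
      nlinarith [Real.exp_pos (M * t), mul_nonneg hBe (Real.exp_pos (M * t)).le]
    · have h1 : |x t| ≤ B := hB t ⟨ht, h⟩
      have h2 : 1 ≤ Real.exp (M * τ) * Real.exp (M * t) := by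
        rw [← Real.exp_add]
        exact Real.one_le_exp (by nlinarith)
      have h3 : 0 ≤ √(E 0) * Real.exp (M * t) := by positivity
      nlinarith
  · have := hsq (v t) t ht (by simp only [hE]; nlinarith [hInn t, sq_nonneg (x t)])
    nlinarith [Real.exp_pos (M * t), mul_nonneg hBe (Real.exp_pos (M * t)).le]

open MeasureTheory in
theorem integrableOn_cexp_mul {g : ℝ → ℝ} {a C M : ℝ} {z : ℂ} (hg : ContinuousOn g (Set.Ici a))
    (hb : ∀ t, a ≤ t → |g t| ≤ C * Real.exp (M * t)) (hz : M < z.re) :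
    IntegrableOn (fun t : ℝ => Complex.exp (-z * t) * (g t : ℂ)) (Set.Ioi a) := by
  have h := (exp_neg_integrableOn_Ioi a (sub_pos.2 hz)).const_mul C
  refine Integrable.mono' h ?_ ?_
  · refine ContinuousOn.aestronglyMeasurable ?_ measurableSet_Ioi
    exact (by fun_prop : Continuous fun t : ℝ => Complex.exp (-z * t)).continuousOn.mul
      (Complex.continuous_ofReal.comp_continuousOn (hg.mono Set.Ioi_subset_Ici_self))
  · filter_upwards [ae_restrict_mem measurableSet_Ioi] with t ht
    rw [norm_mul, Complex.norm_exp, Complex.norm_real, Real.norm_eq_abs, Complex.re_mul_ofReal,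
      Complex.neg_re]
    have := mul_le_mul_of_nonneg_left (hb t (le_of_lt ht)) (Real.exp_pos (-z.re * t)).le
    refine this.trans_eq ?_
    rw [mul_left_comm, ← Real.exp_add]
    congr 2; ring

theorem tendsto_cexp_mul {g : ℝ → ℝ} {C M : ℝ} {z : ℂ}
    (hb : ∀ t, 0 ≤ t → |g t| ≤ C * Real.exp (M * t)) (hz : M < z.re) :
    Tendsto (fun t : ℝ => Complex.exp (-z * t) * (g t : ℂ)) atTop (𝓝 0) := by
  have h0 : Tendsto (fun t : ℝ => C * Real.exp (-((z.re - M) * t))) atTop (𝓝 0) := by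
    have := (Real.tendsto_exp_neg_atTop_nhds_zero.comp
      (tendsto_id.const_mul_atTop (sub_pos.2 hz))).const_mul C
    simpa [Function.comp_def] using this
  refine squeeze_zero_norm' ?_ h0
  filter_upwards [eventually_ge_atTop 0] with t ht
  rw [norm_mul, Complex.norm_exp, Complex.norm_real, Real.norm_eq_abs, Complex.re_mul_ofReal,
    Complex.neg_re]
  have := mul_le_mul_of_nonneg_left (hb t ht) (Real.exp_pos (-z.re * t)).le
  refine this.trans_eq ?_
  rw [mul_left_comm, ← Real.exp_add]
  congr 2; ring

/-- The contribution of the history on `[-τ, 0]` to the Laplace transform of a delayed function. -/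
noncomputable def historyTransform (τ : ℝ) (x : ℝ → ℝ) (z : ℂ) : ℂ :=
  ∫ s in (-τ)..0, Complex.exp (-z * (s + τ)) * (x s : ℂ)

theorem norm_historyTransform_le {τ : ℝ} (hτ : 0 ≤ τ) {x : ℝ → ℝ} (hx : Continuous x) :
    ∃ B : ℝ, 0 ≤ B ∧ ∀ z : ℂ, 0 ≤ z.re → ‖historyTransform τ x z‖ ≤ B := by
  obtain ⟨B, hB⟩ := (isCompact_Icc (a := -τ) (b := 0)).exists_bound_of_continuousOn hx.continuousOn
  have hB0 : 0 ≤ B := (norm_nonneg _).trans (hB 0 ⟨by linarith, le_rfl⟩)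
  refine ⟨B * |0 - -τ|, by positivity, fun z hz => ?_⟩
  refine intervalIntegral.norm_integral_le_of_norm_le_const fun s hs => ?_
  rw [Set.uIoc_of_le (by linarith)] at hs
  have h1 := hB s ⟨hs.1.le, hs.2⟩
  have h2 : Real.exp (-z.re * (s + τ)) ≤ 1 :=
    Real.exp_le_one_iff.2 (by nlinarith [hs.1])
  rw [← Complex.ofReal_add, norm_mul, Complex.norm_exp, Complex.norm_real, Complex.re_mul_ofReal,
    Complex.neg_re]
  nlinarith [norm_nonneg (x s), Real.exp_pos (-z.re * (s + τ))]

theorem differentiable_historyTransform (τ : ℝ) {x : ℝ → ℝ} (hx : Continuous x) :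
    Differentiable ℂ (historyTransform τ x) := by
  intro z
  set F' : ℂ → ℝ → ℂ := fun z s => -(s + τ) * Complex.exp (-z * (s + τ)) * (x s : ℂ) with hF'
  have hc : Continuous fun p : ℂ × ℝ => F' p.1 p.2 := by
    have := Complex.continuous_ofReal.comp hx
    simp only [hF']
    fun_prop
  obtain ⟨B, hB⟩ := ((isCompact_closedBall z 1).prod (isCompact_uIcc (a := -τ) (b := 0))
    ).exists_bound_of_continuousOn hc.continuousOn
  have hcF : ∀ z : ℂ, Continuous fun s : ℝ => Complex.exp (-z * (s + τ)) * (x s : ℂ) := by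
    intro z
    fun_prop
  have := intervalIntegral.hasDerivAt_integral_of_dominated_loc_of_deriv_le (𝕜 := ℂ)
    (μ := MeasureTheory.volume) (a := -τ) (b := 0) (bound := fun _ => B)
    (F := fun (z : ℂ) (s : ℝ) => Complex.exp (-z * (s + τ)) * (x s : ℂ)) (F' := F')
    (Metric.closedBall_mem_nhds z one_pos)
    (Eventually.of_forall fun z => (hcF z).aestronglyMeasurable)
    ((hcF z).intervalIntegrable _ _)
    ((by fun_prop : Continuous fun s : ℝ => F' z s).aestronglyMeasurable)
    (Eventually.of_forall fun s hs w hw => hB (w, s) ⟨hw, Set.uIoc_subset_uIcc hs⟩)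
    intervalIntegrable_const
    (Eventually.of_forall fun s _ w _ => by
      have h1 : HasDerivAt (fun w : ℂ => -w * ((s : ℂ) + τ)) (-((s : ℂ) + τ)) w := by
        simpa using (hasDerivAt_id w).neg.mul_const ((s : ℂ) + τ)
      exact (h1.cexp.mul_const (x s : ℂ)).congr_deriv (by simp only [hF']; ring))
  exact this.2.differentiableAt

open MeasureTheory in
theorem laplace_delay {τ : ℝ} {x : ℝ → ℝ} (hτ : 0 ≤ τ) (hx : Continuous x) {C M : ℝ}
    (hxb : ∀ t, -τ ≤ t → |x t| ≤ C * Real.exp (M * t)) {z : ℂ} (hz : M < z.re) :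
    IntegrableOn (fun t : ℝ => Complex.exp (-z * t) * (x (t - τ) : ℂ)) (Set.Ioi 0) ∧
    ∫ t in Set.Ioi (0 : ℝ), Complex.exp (-z * t) * (x (t - τ) : ℂ) = historyTransform τ x z
      + Complex.exp (-z * τ) * ∫ t in Set.Ioi (0 : ℝ), Complex.exp (-z * t) * (x t : ℂ) := by
  have hi := integrableOn_cexp_mul (a := -τ) hx.continuousOn hxb hz
  have hi' : IntegrableOn (fun s : ℝ => Complex.exp (-z * (s + τ)) * (x s : ℂ)) (Set.Ioi (-τ)) := by
    refine (hi.const_mul (Complex.exp (-z * τ))).congr (Eventually.of_forall fun s => ?_)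
    simp only
    rw [← mul_assoc, ← Complex.exp_add]
    congr 2; ring
  have hmp := measurePreserving_sub_right (volume : Measure ℝ) τ
  have hemb := (MeasurableEquiv.subRight τ).measurableEmbedding
  have hpre : (fun t : ℝ => t - τ) ⁻¹' Set.Ioi (-τ) = Set.Ioi 0 := by simp
  have hfun : (fun t : ℝ => Complex.exp (-z * t) * (x (t - τ) : ℂ))
      = (fun s : ℝ => Complex.exp (-z * (s + τ)) * (x s : ℂ)) ∘ fun t => t - τ := by
    funext t
    simp
  constructor
  · rw [hfun, ← hpre]
    exact (hmp.integrableOn_comp_preimage hemb).2 hi'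
  · have h1 := hmp.setIntegral_preimage_emb hemb
      (fun s : ℝ => Complex.exp (-z * (s + τ)) * (x s : ℂ)) (Set.Ioi (-τ))
    rw [hpre] at h1
    simp only [Complex.ofReal_sub, sub_add_cancel] at h1
    rw [h1, ← intervalIntegral.integral_interval_add_Ioi hi' 
      (hi'.mono_set (Set.Ioi_subset_Ioi (neg_nonpos.2 hτ))),
      historyTransform, ← integral_const_mul]
    congr 2
    funext s
    rw [← mul_assoc, ← Complex.exp_add]
    congr 2; ring

open MeasureTheory in
theorem laplace_eq {p q k τ : ℝ} (hτ : 0 ≤ τ) {x v : ℝ → ℝ} (hx : Continuous x)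
    (hdx : ∀ t, 0 ≤ t → HasDerivWithinAt x (v t) (Set.Ici 0) t)
    (hdv : ∀ t, 0 ≤ t → HasDerivWithinAt v (p * v t - q * x t + k * x (t - τ)) (Set.Ici 0) t)
    {C M : ℝ} (hxb : ∀ t, -τ ≤ t → |x t| ≤ C * Real.exp (M * t))
    (hvb : ∀ t, 0 ≤ t → |v t| ≤ C * Real.exp (M * t)) {z : ℂ} (hz : M < z.re) :
    (z ^ 2 - p * z + q - k * Complex.exp (-z * τ))
        * ∫ t in Set.Ioi (0 : ℝ), Complex.exp (-z * t) * (x t : ℂ)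
      = v 0 + (z - p) * x 0 + k * historyTransform τ x z := by
  have hxb0 : ∀ t, 0 ≤ t → |x t| ≤ C * Real.exp (M * t) := fun t ht => hxb t (by linarith)
  obtain ⟨hid, hed⟩ := laplace_delay hτ hx hxb hz
  have hix := integrableOn_cexp_mul (a := 0) hx.continuousOn hxb0 hz
  -- The coefficient `z - p` is chosen so that `v` cancels from `Φ'`; only transforms of `x` and of
  -- its delay remain.
  set Φ : ℝ → ℂ := fun t => Complex.exp (-z * t) * (v t : ℂ)
    + (z - p) * (Complex.exp (-z * t) * (x t : ℂ)) with hΦ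
  set Φ' : ℝ → ℂ := fun t => -(z ^ 2 - p * z + q) * (Complex.exp (-z * t) * (x t : ℂ))
    + k * (Complex.exp (-z * t) * (x (t - τ) : ℂ)) with hΦ'
  have hexp : ∀ t : ℝ, HasDerivAt (fun t : ℝ => Complex.exp (-z * t))
      (-z * Complex.exp (-z * t)) t := by
    intro t
    have h1 : HasDerivAt (fun t : ℝ => -z * (t : ℂ)) (-z) t := by
      simpa using (Complex.ofRealCLM.hasDerivAt (x := t)).const_mul (-z)
    exact h1.cexp.congr_deriv (mul_comm _ _)
  have hd : ∀ t, 0 ≤ t → HasDerivWithinAt Φ (Φ' t) (Set.Ici 0) t := by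
    intro t ht
    have h1 := (hdx t ht).ofReal_comp
    have h2 := (hdv t ht).ofReal_comp
    refine (((hexp t).hasDerivWithinAt.mul h2).add
      (((hexp t).hasDerivWithinAt.mul h1).const_mul (z - p))).congr_deriv ?_
    simp only [hΦ']
    push_cast
    ring
  have hint : IntegrableOn Φ' (Set.Ioi 0) := (hix.const_mul _).add (hid.const_mul _)
  have hlim : Tendsto Φ atTop (𝓝 0) := by
    simpa [hΦ] using (tendsto_cexp_mul hvb hz).add ((tendsto_cexp_mul hxb0 hz).const_mul (z - p))
  have h := integral_Ioi_of_hasDerivAt_of_tendsto (hd 0 le_rfl).continuousWithinAt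
    (fun t ht => (hd t (le_of_lt ht)).hasDerivAt (Ici_mem_nhds ht)) hint hlim
  simp only [hΦ'] at h
  rw [integral_add (hix.const_mul _) (hid.const_mul _), integral_const_mul, integral_const_mul,
    hed] at h
  simp only [hΦ, Complex.ofReal_zero, mul_zero, Complex.exp_zero, one_mul] at h
  linear_combination -h

/-- Compactness handles `‖z‖ ≤ 4s`. Beyond that, the lower-order terms are at most `s‖z‖ ≤ ‖z‖² /
4`. -/
theorem quasipolynomial_lower_bound {p q k τ : ℝ} (hτ : 0 ≤ τ)
    (hroot : ∀ z : ℂ, 0 ≤ z.re → z ^ 2 - p * z + q - k * Complex.exp (-z * τ) ≠ 0) :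
    ∃ c : ℝ, 0 < c ∧ ∀ z : ℂ, 0 ≤ z.re →
      c * (1 + ‖z‖ ^ 2) ≤ ‖z ^ 2 - p * z + q - k * Complex.exp (-z * τ)‖ := by
  set D : ℂ → ℂ := fun z => z ^ 2 - p * z + q - k * Complex.exp (-z * τ) with hD
  have hDc : Continuous D := by fun_prop
  set s := |p| + |q| + |k| + 1 with hs
  have hs1 : 1 ≤ s := by
    have := abs_nonneg p; have := abs_nonneg q; have := abs_nonneg k
    linarith
  have hcpt : IsCompact (Metric.closedBall (0 : ℂ) (4 * s) ∩ {z | 0 ≤ z.re}) :=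
    (isCompact_closedBall _ _).inter_right (isClosed_le continuous_const Complex.continuous_re)
  obtain ⟨w, hw, hmin⟩ := hcpt.exists_isMinOn
    ⟨0, Metric.mem_closedBall_self (by linarith), by simp⟩ hDc.norm.continuousOn
  have hm : 0 < ‖D w‖ := norm_pos_iff.2 (hroot w hw.2)
  refine ⟨min (1 / 4) (‖D w‖ / (1 + (4 * s) ^ 2)), by positivity, fun z hz => ?_⟩
  rcases le_total ‖z‖ (4 * s) with h | h
  · have h1 : ‖D w‖ ≤ ‖D z‖ := hmin ⟨mem_closedBall_zero_iff.2 h, hz⟩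
    refine le_trans ?_ h1
    calc min (1 / 4) (‖D w‖ / (1 + (4 * s) ^ 2)) * (1 + ‖z‖ ^ 2)
        ≤ ‖D w‖ / (1 + (4 * s) ^ 2) * (1 + (4 * s) ^ 2) := by
          gcongr
          exact min_le_right _ _
      _ = ‖D w‖ := by field_simp
  · have h2 : ‖z‖ ^ 2 ≤ ‖D z‖ + |p| * ‖z‖ + |q| + |k| := by
      have e : z ^ 2 = D z + p * z - q + k * Complex.exp (-z * τ) := by simp only [hD]; ring
      have he : ‖(k : ℂ) * Complex.exp (-z * τ)‖ ≤ |k| := by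
        rw [norm_mul, Complex.norm_real, Real.norm_eq_abs, Complex.norm_exp]
        refine mul_le_of_le_one_right (abs_nonneg k) (Real.exp_le_one_iff.2 ?_)
        rw [Complex.re_mul_ofReal, Complex.neg_re]
        nlinarith
      calc ‖z‖ ^ 2 = ‖D z + p * z - q + k * Complex.exp (-z * τ)‖ := by rw [← e, norm_pow]
        _ ≤ ‖D z‖ + ‖(p : ℂ) * z‖ + ‖(q : ℂ)‖ + ‖(k : ℂ) * Complex.exp (-z * τ)‖ :=
          (norm_add_le _ _).trans (by
            gcongr
            exact (norm_sub_le _ _).trans (by gcongr; exact norm_add_le _ _))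
        _ ≤ _ := by
          rw [norm_mul, Complex.norm_real, Complex.norm_real, Real.norm_eq_abs, Real.norm_eq_abs]
          gcongr
    have h3 : min (1 / 4) (‖D w‖ / (1 + (4 * s) ^ 2)) * (1 + ‖z‖ ^ 2) ≤ 1 / 4 * (1 + ‖z‖ ^ 2) := by
      gcongr
      exact min_le_left _ _
    refine h3.trans ?_
    have h4 : |p| * ‖z‖ + |q| + |k| ≤ s * ‖z‖ := by
      have hn1 : 1 ≤ ‖z‖ := by linarith
      nlinarith [abs_nonneg q, abs_nonneg k, mul_nonneg (abs_nonneg q) (sub_nonneg.2 hn1),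
        mul_nonneg (abs_nonneg k) (sub_nonneg.2 hn1)]
    have h5 : s * ‖z‖ ≤ ‖z‖ / 4 * ‖z‖ := by
      gcongr
      linarith
    change 1 / 4 * (1 + ‖z‖ ^ 2) ≤ ‖D z‖
    nlinarith

/-- The Laplace transform of `x t - x 0 * exp (-t)` for a solution `x` of the delay equation. -/
noncomputable def solutionTransform (p q k τ v₀ : ℝ) (x : ℝ → ℝ) (z : ℂ) : ℂ :=
  (v₀ + (z - p) * x 0 + k * historyTransform τ x z) / (z ^ 2 - p * z + q - k * Complex.exp (-z * τ))
    - x 0 / (z + 1)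

theorem add_one_ne_zero_of_re_nonneg {z : ℂ} (hz : 0 ≤ z.re) : z + 1 ≠ 0 := by
  intro h
  have := congrArg Complex.re h
  simp at this
  linarith

theorem norm_solutionTransform_le {p q k τ v₀ : ℝ} (hτ : 0 ≤ τ)
    (hroot : ∀ z : ℂ, 0 ≤ z.re → z ^ 2 - p * z + q - k * Complex.exp (-z * τ) ≠ 0)
    {x : ℝ → ℝ} (hx : Continuous x) :
    ∃ A : ℝ, 0 ≤ A ∧ ∀ z : ℂ, 0 ≤ z.re →
      ‖solutionTransform p q k τ v₀ x z‖ ≤ A * (1 + z.im ^ 2)⁻¹ := by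
  obtain ⟨c, hc, hlow⟩ := quasipolynomial_lower_bound hτ hroot
  obtain ⟨B, hB0, hB⟩ := norm_historyTransform_le hτ hx
  set A := |x 0| * (1 + |p| + |q| + |k|) + |v₀| + |k| * B with hA
  have hA0 : 0 ≤ A := by positivity
  refine ⟨2 * A / c, by positivity, fun z hz => ?_⟩
  set d := z ^ 2 - p * z + q - k * Complex.exp (-z * τ) with hd
  have hd0 : d ≠ 0 := hroot z hz
  have hz1 := add_one_ne_zero_of_re_nonneg hz
  -- Subtracting the transform of `x 0 * exp (-t)` cancels the `z ^ 2` terms. The numerator grows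
  -- only linearly over a cubic denominator, which gives the quadratic decay needed for absolute
  -- integrability.
  set W : ℂ := x 0 * (z - p - q + k * Complex.exp (-z * τ))
    + (v₀ + k * historyTransform τ x z) * (z + 1) with hW
  have hY : solutionTransform p q k τ v₀ x z = W / (d * (z + 1)) := by
    rw [solutionTransform, ← hd, div_sub_div _ _ hd0 hz1]
    congr 1
    rw [hW, hd]
    ring
  have he : ‖Complex.exp (-z * τ)‖ ≤ 1 := by
    rw [Complex.norm_exp, Real.exp_le_one_iff, Complex.re_mul_ofReal, Complex.neg_re]
    nlinarith
  have hWn : ‖W‖ ≤ A * (‖z‖ + 1) := by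
    have h1 : ‖z - p - q + k * Complex.exp (-z * τ)‖ ≤ ‖z‖ + |p| + |q| + |k| := by
      refine (norm_add_le _ _).trans (add_le_add ((norm_sub_le _ _).trans
        (add_le_add ((norm_sub_le _ _).trans ?_) ?_)) ?_)
      · rw [Complex.norm_real, Real.norm_eq_abs]
      · rw [Complex.norm_real, Real.norm_eq_abs]
      · rw [norm_mul, Complex.norm_real, Real.norm_eq_abs]
        exact mul_le_of_le_one_right (abs_nonneg k) he
    have h2 : ‖(v₀ : ℂ) + k * historyTransform τ x z‖ ≤ |v₀| + |k| * B := by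
      refine (norm_add_le _ _).trans ?_
      rw [norm_mul, Complex.norm_real, Complex.norm_real, Real.norm_eq_abs, Real.norm_eq_abs]
      gcongr
      exact hB z hz
    have h3 : ‖z + 1‖ ≤ ‖z‖ + 1 := (norm_add_le _ _).trans (by simp)
    calc ‖W‖ ≤ |x 0| * (‖z‖ + |p| + |q| + |k|) + (|v₀| + |k| * B) * (‖z‖ + 1) := by
          refine (norm_add_le _ _).trans ?_
          rw [norm_mul, norm_mul, Complex.norm_real, Real.norm_eq_abs]
          gcongr
      _ ≤ A * (‖z‖ + 1) := by
          have : 0 ≤ |x 0| * (1 + (|p| + |q| + |k|) * ‖z‖) := by positivity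
          rw [hA]
          nlinarith
  have hzn : (‖z‖ + 1) ≤ 2 * ‖z + 1‖ := by
    have h1 : ‖z‖ ≤ ‖z + 1‖ := by
      refine (sq_le_sq₀ (norm_nonneg _) (norm_nonneg _)).1 ?_
      rw [← Complex.normSq_eq_norm_sq, ← Complex.normSq_eq_norm_sq, Complex.normSq_apply,
        Complex.normSq_apply]
      simp only [Complex.add_re, Complex.one_re, Complex.add_im, Complex.one_im]
      nlinarith
    have h2 : 1 ≤ ‖z + 1‖ := by
      refine le_trans ?_ (Complex.re_le_norm _)
      simpa using hz
    linarith
  have hdl := hlow z hz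
  have him : 1 + z.im ^ 2 ≤ 1 + ‖z‖ ^ 2 := by
    have := Complex.abs_im_le_norm z
    have := sq_le_sq' (by linarith [neg_abs_le z.im, norm_nonneg z]) ((le_abs_self _).trans this)
    linarith
  rw [hY, norm_div, norm_mul, ← div_eq_mul_inv, div_div,
    div_le_div_iff₀ (mul_pos (norm_pos_iff.2 hd0) (norm_pos_iff.2 hz1)) (by positivity)]
  have hl : c * (1 + z.im ^ 2) ≤ ‖d‖ := (mul_le_mul_of_nonneg_left him hc.le).trans hdl
  calc ‖W‖ * (c * (1 + z.im ^ 2)) ≤ (A * (‖z‖ + 1)) * ‖d‖ := by gcongr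
    _ ≤ (A * (2 * ‖z + 1‖)) * ‖d‖ := by gcongr
    _ = 2 * A * (‖d‖ * ‖z + 1‖) := by ring

theorem differentiableAt_solutionTransform {p q k τ v₀ : ℝ}
    (hroot : ∀ z : ℂ, 0 ≤ z.re → z ^ 2 - p * z + q - k * Complex.exp (-z * τ) ≠ 0)
    {x : ℝ → ℝ} (hx : Continuous x) {z : ℂ} (hz : 0 ≤ z.re) :
    DifferentiableAt ℂ (solutionTransform p q k τ v₀ x) z := by
  have h1 := differentiable_historyTransform τ hx z
  have h2 := hroot z hz
  have h3 := add_one_ne_zero_of_re_nonneg hz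
  unfold solutionTransform
  fun_prop (disch := assumption)

-- Fourier inversion on `Re z = M + 1`, where the Laplace integral converges, recovers `x t - x 0 *
-- exp (-t)`. Shifting to `Re z = 0` removes the factor `exp (c * t)` and leaves the Fourier
-- integral of an integrable function.
open MeasureTheory FourierTransform in
theorem tendsto_zero_of_no_root {p q k τ : ℝ} (hτ : 0 ≤ τ)
    (hroot : ∀ z : ℂ, 0 ≤ z.re → z ^ 2 - p * z + q - k * Complex.exp (-z * τ) ≠ 0)
    {x v : ℝ → ℝ} (hx : Continuous x)
    (hdx : ∀ t, 0 ≤ t → HasDerivWithinAt x (v t) (Set.Ici 0) t)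
    (hdv : ∀ t, 0 ≤ t → HasDerivWithinAt v (p * v t - q * x t + k * x (t - τ)) (Set.Ici 0) t) :
    Tendsto x atTop (𝓝 0) := by
  obtain ⟨C, M, hM, hxb, hvb⟩ := delay_exp_bound hτ hx hdx hdv
  have hxb0 : ∀ t, 0 ≤ t → |x t| ≤ C * Real.exp (M * t) := fun t ht => hxb t (by linarith)
  set Y := solutionTransform p q k τ (v 0) x with hY
  obtain ⟨A, hA0, hA⟩ := norm_solutionTransform_le (v₀ := v 0) hτ hroot hx
  have hYd : ∀ z : ℂ, 0 ≤ z.re → DifferentiableAt ℂ Y z := fun z hz =>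
    differentiableAt_solutionTransform hroot hx hz
  set y : ℝ → ℝ := fun t => x t - x 0 * Real.exp (-t) with hy
  have hyc : Continuous y := by fun_prop
  have hy0 : y 0 = 0 := by simp [hy]
  have heb : ∀ t, 0 ≤ t → |Real.exp (-t)| ≤ 1 * Real.exp (M * t) := fun t ht => by
    rw [abs_of_pos (Real.exp_pos _), one_mul, Real.exp_le_exp]
    nlinarith
  have hec : Continuous fun t : ℝ => Real.exp (-t) := by fun_prop
  have hyI : ∀ z : ℂ, M < z.re →
      IntegrableOn (fun t : ℝ => Complex.exp (-z * t) * (y t : ℂ)) (Set.Ioi 0) ∧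
      ∫ t in Set.Ioi (0 : ℝ), Complex.exp (-z * t) * (y t : ℂ) = Y z := by
    intro z hz
    have hz0 : 0 ≤ z.re := by linarith
    have h1 := integrableOn_cexp_mul hx.continuousOn hxb0 hz
    have h2 := integrableOn_cexp_mul hec.continuousOn heb hz
    have hfun : (fun t : ℝ => Complex.exp (-z * t) * (y t : ℂ)) = fun t : ℝ =>
        Complex.exp (-z * t) * (x t : ℂ)
          - x 0 * (Complex.exp (-z * t) * (Real.exp (-t) : ℝ)) := by
      funext t
      simp only [hy]
      push_cast
      ring
    rw [hfun]
    refine ⟨h1.sub (h2.const_mul _), ?_⟩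
    rw [integral_sub h1 (h2.const_mul _), integral_const_mul]
    have h3 := laplace_eq hτ hx hdx hdv hxb hvb hz
    have h4 : ∫ t in Set.Ioi (0 : ℝ), Complex.exp (-z * t) * (Real.exp (-t) : ℝ) = 1 / (z + 1) := by
      have h5 := integral_exp_mul_complex_Ioi (a := -(z + 1)) (by simp; linarith) 0
      simp only [Complex.ofReal_zero, mul_zero, Complex.exp_zero, neg_div_neg_eq] at h5
      rw [← h5]
      congr 1
      funext t
      rw [Complex.ofReal_exp, ← Complex.exp_add]
      congr 1
      push_cast
      ring
    rw [h4, hY, solutionTransform, ← h3, mul_div_cancel_left₀ _ (hroot z hz0)]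
    ring
  set c := M + 1 with hc
  have hc0 : 0 ≤ c := by linarith
  -- As `y 0 = 0`, clamping the argument extends the function continuously by zero to negative
  -- times.
  set f : ℝ → ℂ := fun t => Complex.exp (-c * t) * (y (max t 0) : ℂ) with hf
  have hfc : Continuous f := by fun_prop
  have hfind : ∀ g : ℝ → ℂ, (fun t => g t * f t) = Set.indicator (Set.Ioi 0)
      fun t : ℝ => g t * (Complex.exp (-c * t) * (y t : ℂ)) := by
    intro g
    funext t
    by_cases ht : 0 < t
    · rw [Set.indicator_of_mem (Set.mem_Ioi.2 ht)]
      simp only [hf, max_eq_left ht.le]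
    · rw [Set.indicator_of_notMem (by simpa using ht)]
      simp only [hf, max_eq_right (not_lt.1 ht), hy0]
      simp
  have hfI : Integrable f := by
    have h := hfind fun _ => 1
    simp only [one_mul] at h
    rw [show f = fun t => f t from rfl, h, integrable_indicator_iff measurableSet_Ioi]
    exact (hyI c (by simp [hc])).1
  have hFf : ∀ ξ : ℝ, 𝓕 f ξ = Y (c + (2 * Real.pi * ξ : ℝ) * Complex.I) := by
    intro ξ
    rw [Real.fourier_real_eq_integral_exp_smul]
    simp only [smul_eq_mul]
    rw [hfind, integral_indicator measurableSet_Ioi,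
      ← (hyI (c + (2 * Real.pi * ξ : ℝ) * Complex.I) (by simp [hc])).2]
    congr 1
    funext t
    rw [← mul_assoc, ← Complex.exp_add]
    congr 2
    push_cast
    ring
  have hYI : Integrable fun u : ℝ => Y (c + u * Complex.I) := by
    have hcont : Continuous fun u : ℝ => Y (c + u * Complex.I) := by
      refine continuous_iff_continuousAt.2 fun u => ?_
      have h1 := (hYd (c + u * Complex.I) (by simpa using hc0)).continuousAt
      exact ContinuousAt.comp (f := fun u : ℝ => (c + u * Complex.I : ℂ)) h1 (by fun_prop)
    refine (integrable_inv_one_add_sq.const_mul A).mono' hcont.aestronglyMeasurable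
      (Eventually.of_forall fun u => ?_)
    simpa using hA (c + u * Complex.I) (by simpa using hc0)
  have h2pi : (2 * Real.pi) ≠ 0 := by positivity
  have hFI : Integrable (𝓕 f) := by
    rw [show 𝓕 f = fun ξ => Y (c + (2 * Real.pi * ξ : ℝ) * Complex.I) from funext hFf]
    exact hYI.comp_mul_left' h2pi
  have hyt : ∀ t, 0 ≤ t → (y t : ℂ)
      = ∫ ξ : ℝ, Complex.exp ((2 * Real.pi * ξ * t : ℝ) * Complex.I)
        * Y ((2 * Real.pi * ξ : ℝ) * Complex.I) := by
    intro t ht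
    have hinv := congrFun (hfc.fourierInv_fourier_eq hfI hFI) t
    rw [Real.fourierInv_eq'] at hinv
    have hshift := integral_vertical_eq (g := fun z => Complex.exp (z * t) * Y z) (c := c)
      (C := Real.exp (c * t) * A) hc0
      (fun z hz => (by fun_prop : DifferentiableAt ℂ (fun z : ℂ => Complex.exp (z * t)) z).mul
        (hYd z hz))
      (fun z hz hzc => by
        rw [norm_mul, Complex.norm_exp, Complex.re_mul_ofReal, mul_assoc]
        gcongr
        exact hA z hz)
    have h1 := Measure.integral_comp_mul_left (fun u : ℝ =>
      Complex.exp ((c + u * Complex.I) * t) * Y (c + u * Complex.I)) (2 * Real.pi)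
    have h2 := Measure.integral_comp_mul_left (fun u : ℝ =>
      Complex.exp ((u * Complex.I) * t) * Y (u * Complex.I)) (2 * Real.pi)
    rw [hshift, ← h2] at h1
    have hlhs : (y t : ℂ) = Complex.exp (c * t) * f t := by
      simp only [hf, max_eq_left ht]
      rw [← mul_assoc, ← Complex.exp_add]
      simp
    rw [hlhs, ← hinv, ← integral_const_mul]
    refine Eq.trans ?_ (h1.trans ?_)
    · congr 1
      funext ξ
      rw [hFf, smul_eq_mul, ← mul_assoc, ← Complex.exp_add]
      congr 2
      simp
      ring
    · congr 1
      funext ξ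
      congr 2
      push_cast
      ring
  have hRL := (Real.tendsto_integral_exp_smul_cocompact
    fun ξ : ℝ => Y ((2 * Real.pi * ξ : ℝ) * Complex.I)).comp
      (tendsto_neg_atTop_atBot.mono_right atBot_le_cocompact)
  have hy1 : Tendsto (fun t => (y t : ℂ)) atTop (𝓝 0) := by
    refine hRL.congr' ?_
    filter_upwards [eventually_ge_atTop 0] with t ht
    rw [hyt t ht, Function.comp_apply]
    congr 1
    funext ξ
    rw [Circle.smul_def, Real.fourierChar_apply, smul_eq_mul]
    congr 3
    push_cast
    ring
  have hy2 : Tendsto y atTop (𝓝 0) := by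
    have := (Complex.continuous_re.tendsto 0).comp hy1
    simpa [Function.comp_def] using this
  have hy3 : Tendsto (fun t : ℝ => x 0 * Real.exp (-t)) atTop (𝓝 0) := by
    simpa using Real.tendsto_exp_neg_atTop_nhds_zero.const_mul (x 0)
  have := hy2.add hy3
  simpa [hy] using this

/-! ### From the scalar equation back to the system, and the case analysis -/

theorem dyadStable_of_no_root {a₁₁ a₁₂ a₂₁ a₂₂ τ : ℝ} (hτ : 0 ≤ τ)
    (hroot : ∀ z : ℂ, 0 ≤ z.re → dyadChar a₁₁ a₁₂ a₂₁ a₂₂ τ z ≠ 0) :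
    DyadStable a₁₁ a₁₂ a₂₁ a₂₂ τ := by
  intro r j hs
  have hroot' : ∀ z : ℂ, 0 ≤ z.re → z ^ 2 - (a₁₁ + a₂₂ : ℝ) * z + (a₁₁ * a₂₂ : ℝ)
      - (a₁₂ * a₂₁ : ℝ) * Complex.exp (-z * τ) ≠ 0 := by
    intro z hz h
    refine hroot z hz ?_
    rw [← h, dyadChar]
    push_cast
    ring
  -- Eliminating `r` gives the scalar equation for `j`; clamping at `-τ` makes the history
  -- continuous on the whole line.
  have hj : Tendsto (fun t => j (max t (-τ))) atTop (𝓝 0) := by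
    have heq : ∀ t, -τ ≤ t → j (max t (-τ)) = j t := fun t ht => by rw [max_eq_left ht]
    have hval : ∀ t ∈ Set.Ici (0 : ℝ), j (max t (-τ)) = j t :=
      fun t ht => heq t (by linarith [Set.mem_Ici.1 ht])
    refine tendsto_zero_of_no_root hτ hroot' (v := fun t => a₂₁ * r t + a₂₂ * j t)
      (hs.continuousOn_j.comp_continuous (by fun_prop) fun t => Set.mem_Ici.2 (le_max_right _ _))
      (fun t ht => (hs.deriv_j t ht).congr hval (hval t ht)) fun t ht => ?_
    refine (((hs.deriv_r t ht).const_mul a₂₁).add ((hs.deriv_j t ht).const_mul a₂₂)).congr_deriv ?_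
    rw [hval t ht, heq (t - τ) (by linarith)]
    ring
  -- The equation for `r` contains `j (t - τ)`, differentiable only from time `τ` on. The shifted
  -- function `r (t + τ)` does satisfy the scalar equation from `t = 0`, with `r` on `[0, τ]` as its
  -- history.
  have hr : Tendsto (fun t => r (max (t + τ) 0)) atTop (𝓝 0) := by
    have heq : ∀ t, 0 ≤ t + τ → r (max (t + τ) 0) = r (t + τ) := fun t ht => by rw [max_eq_left ht]
    have hval : ∀ t ∈ Set.Ici (0 : ℝ), r (max (t + τ) 0) = r (t + τ) :=
      fun t ht => heq t (by linarith [Set.mem_Ici.1 ht])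
    have hdr : ∀ t, 0 ≤ t → HasDerivWithinAt (fun t => r (t + τ))
        (a₁₁ * r (t + τ) + a₁₂ * j t) (Set.Ici 0) t := by
      intro t ht
      have hm : Set.MapsTo (fun s => s + τ) (Set.Ici 0) (Set.Ici 0) :=
        fun s hs => add_nonneg hs hτ
      have h1 := (hs.deriv_r (t + τ) (by linarith)).comp t
        ((hasDerivAt_id t).add_const τ).hasDerivWithinAt hm
      refine h1.congr_deriv ?_
      rw [add_sub_cancel_right, mul_one]
    refine tendsto_zero_of_no_root hτ hroot' (v := fun t => a₁₁ * r (t + τ) + a₁₂ * j t)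
      (hs.continuousOn_r.comp_continuous (by fun_prop) fun t => ?_)
      (fun t ht => (hdr t ht).congr hval (hval t ht)) fun t ht => ?_
    · exact (neg_nonpos.2 hτ).trans (le_max_right _ _)
    · refine (((hdr t ht).const_mul a₁₁).add ((hs.deriv_j t ht).const_mul a₁₂)).congr_deriv ?_
      rw [hval t ht, heq (t - τ) (by linarith), sub_add_cancel]
      ring
  refine Tendsto.prodMk_nhds ?_ ?_
  · refine (hr.comp (tendsto_atTop_add_const_right _ (-τ) tendsto_id)).congr' ?_
    filter_upwards [eventually_ge_atTop 0] with t ht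
    simp [max_eq_left ht]
  · refine hj.congr' ?_
    filter_upwards [eventually_ge_atTop 0] with t ht
    rw [max_eq_left (by linarith)]

/-- With zero trace `j'' = -D j`, so `j' ^ 2 + D * j ^ 2` is conserved and bounds `j` and `j'`; `a₂₁
≠ 0` then recovers `r`. -/
theorem not_dyadUnstable_of_center {a₁₁ a₁₂ a₂₁ a₂₂ : ℝ} (htr : a₁₁ + a₂₂ = 0)
    (hdet : 0 < a₁₁ * a₂₂ - a₁₂ * a₂₁) (h21 : a₂₁ ≠ 0) : ¬ DyadUnstable a₁₁ a₁₂ a₂₁ a₂₂ 0 := by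
  rintro ⟨r, j, hs, hu⟩
  set D := a₁₁ * a₂₂ - a₁₂ * a₂₁ with hD
  set v : ℝ → ℝ := fun t => a₂₁ * r t + a₂₂ * j t with hv
  set E : ℝ → ℝ := fun t => v t ^ 2 + D * j t ^ 2 with hE
  have hdE : ∀ t, 0 ≤ t → HasDerivWithinAt E 0 (Set.Ici 0) t := by
    intro t ht
    have h1 := ((hs.deriv_r t ht).const_mul a₂₁).add ((hs.deriv_j t ht).const_mul a₂₂)
    refine ((h1.pow 2).add (((hs.deriv_j t ht).pow 2).const_mul D)).congr_deriv ?_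
    have h22 : a₂₂ = -a₁₁ := by linarith
    simp only [sub_zero, hD, h22, Pi.add_apply]
    push_cast
    ring
  have hanti : AntitoneOn E (Set.Ici 0) :=
    antitoneOn_of_hasDerivWithinAt_nonpos (f' := fun _ => 0) (convex_Ici 0)
      (fun t ht => (hdE t ht).continuousWithinAt)
      (fun t ht => (hdE t (interior_subset ht)).mono interior_subset) fun _ _ => le_rfl
  have hb : ∀ t, 0 ≤ t → |v t| ≤ √(E 0) ∧ |j t| ≤ √(E 0 / D) := by
    intro t ht
    have h1 : v t ^ 2 + D * j t ^ 2 ≤ E 0 := hanti Set.self_mem_Ici ht ht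
    have h2 : 0 ≤ D * j t ^ 2 := by positivity
    refine ⟨Real.abs_le_sqrt (by linarith), Real.abs_le_sqrt ?_⟩
    rw [le_div_iff₀ hdet]
    nlinarith [sq_nonneg (v t)]
  obtain ⟨t, ht, hlt⟩ := hu (max ((√(E 0) + |a₂₂| * √(E 0 / D)) / |a₂₁|) (√(E 0 / D)))
  obtain ⟨h1, h2⟩ := hb t ht
  refine absurd hlt (not_lt.2 (max_le_max ?_ h2))
  rw [le_div_iff₀ (abs_pos.2 h21), ← abs_mul]
  have e : r t * a₂₁ = v t - a₂₂ * j t := by simp only [hv]; ring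
  rw [e]
  refine (abs_sub _ _).trans ?_
  rw [abs_mul]
  gcongr

theorem dyadChar_eq_add (a₁₁ a₁₂ a₂₁ a₂₂ τ : ℝ) (z : ℂ) : dyadChar a₁₁ a₁₂ a₂₁ a₂₂ τ z
    = (z - a₁₁) * (z - a₂₂) + (-(a₁₂ * a₂₁) : ℝ) * Complex.exp (-z * τ) := by
  rw [dyadChar]
  push_cast
  ring

theorem dyadUnstable_of_real {a₁₁ a₁₂ a₂₁ a₂₂ τ x₀ : ℝ} (hτ : 0 ≤ τ) (hx₀ : 0 ≤ x₀)
    (h : (x₀ - a₁₁) * (x₀ - a₂₂) - a₁₂ * a₂₁ * Real.exp (-x₀ * τ) ≤ 0)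
    (h0 : a₁₁ * a₂₂ ≠ a₁₂ * a₂₁) : DyadUnstable a₁₁ a₁₂ a₂₁ a₂₂ τ := by
  obtain ⟨x, hx, hr⟩ := exists_real_root hτ hx₀ h
  refine dyadUnstable_of_root (z := x) ?_ ?_
  · have := complex_root_of_real_root hr
    push_cast at this
    exact this
  · refine lt_of_le_of_ne (hx₀.trans hx) fun hzero => h0 ?_
    rw [Complex.ofReal_re] at hzero
    rw [← hzero] at hr
    simp at hr
    linarith

theorem dyadUnstable_of_charPhase {a₁₁ a₁₂ a₂₁ a₂₂ τ : ℝ} (hτ : 0 ≤ τ) (hk : a₁₂ * a₂₁ < 0)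
    (h : Real.pi < charPhase a₁₁ a₂₂ τ (levelPoint a₁₁ a₂₂ (-(a₁₂ * a₂₁)) 0)) :
    DyadUnstable a₁₁ a₁₂ a₂₁ a₂₂ τ := by
  obtain ⟨z, hz, hr⟩ := exists_root_of_charPhase (neg_pos.2 hk) hτ h
  exact dyadUnstable_of_root ((dyadChar_eq_add _ _ _ _ _ _).trans hr) hz

theorem dyadStable_of_small_coupling {a₁₁ a₁₂ a₂₁ a₂₂ τ : ℝ} (hτ : 0 ≤ τ) (h1 : a₁₁ < 0)
    (h2 : a₂₂ < 0) (h : |a₁₂ * a₂₁| < |a₁₁ * a₂₂|) : DyadStable a₁₁ a₁₂ a₂₁ a₂₂ τ := by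
  refine dyadStable_of_no_root hτ fun z hz h0 => ?_
  have hn : ∀ c : ℝ, c < 0 → |c| ≤ ‖z - c‖ := by
    intro c hc
    refine le_trans ?_ (Complex.re_le_norm _)
    rw [abs_of_neg hc, Complex.sub_re, Complex.ofReal_re]
    linarith
  have e := congrArg norm (sub_eq_zero.1 h0)
  have hexp : ‖Complex.exp (-z * τ)‖ ≤ 1 := by
    rw [Complex.norm_exp, Real.exp_le_one_iff, Complex.re_mul_ofReal, Complex.neg_re]
    nlinarith
  rw [norm_mul, norm_mul, ← Complex.ofReal_mul, Complex.norm_real, Real.norm_eq_abs] at e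
  have h3 := mul_le_mul (hn _ h1) (hn _ h2) (abs_nonneg _) (norm_nonneg _)
  rw [← abs_mul] at h3
  have h4 := mul_le_of_le_one_right (abs_nonneg (a₁₂ * a₂₁)) hexp
  linarith

theorem dyadUnstable_of_small_coupling {a₁₁ a₁₂ a₂₁ a₂₂ τ : ℝ} (hτ : 0 ≤ τ)
    (hneg : ¬ (a₁₁ < 0 ∧ a₂₂ < 0)) (h : |a₁₂ * a₂₁| < |a₁₁ * a₂₂|) :
    DyadUnstable a₁₁ a₁₂ a₂₁ a₂₂ τ := by
  have hne : a₁₁ * a₂₂ ≠ a₁₂ * a₂₁ := fun e => by rw [e] at h; exact lt_irrefl _ h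
  have hq0 : a₁₁ * a₂₂ ≠ 0 := abs_pos.1 ((abs_nonneg _).trans_lt h)
  have h11 : a₁₁ ≠ 0 := left_ne_zero_of_mul hq0
  have h22 : a₂₂ ≠ 0 := right_ne_zero_of_mul hq0
  rcases hq0.lt_or_gt with hq | hq
  · refine dyadUnstable_of_real hτ le_rfl ?_ hne
    rw [abs_of_neg hq] at h
    simp
    linarith [neg_abs_le (a₁₂ * a₂₁)]
  · have hpos : 0 < a₁₁ ∧ 0 < a₂₂ := by
      rcases h11.lt_or_gt with h1 | h1
      · exact absurd ⟨h1, by nlinarith⟩ hneg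
      · exact ⟨h1, by nlinarith⟩
    rcases le_or_gt 0 (a₁₂ * a₂₁) with hk | hk
    -- At `x₀ = a₁₁` the product of the factors vanishes.
    · refine dyadUnstable_of_real hτ hpos.1.le ?_ hne
      have := mul_nonneg hk (Real.exp_pos (-a₁₁ * τ)).le
      simpa using this
    · refine dyadUnstable_of_charPhase hτ hk ?_
      -- The starting point is the origin itself, to the left of both `a₁₁` and `a₂₂`: each argument
      -- is `π` and the phase is `2π`.
      have hY : levelSq a₁₁ a₂₂ (-(a₁₂ * a₂₁)) 0 < 0 := by
        rw [levelSq_neg_iff (neg_pos.2 hk), ← abs_of_neg hk]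
        simpa using h
      have hz : levelPoint a₁₁ a₂₂ (-(a₁₂ * a₂₁)) 0 = ((0 : ℝ) : ℂ) := by
        unfold levelPoint
        rw [Real.sqrt_eq_zero_of_nonpos hY.le]
        rfl
      rw [hz, charPhase, ← Complex.ofReal_sub, ← Complex.ofReal_sub,
        Complex.arg_ofReal_of_neg (by linarith [hpos.1]),
        Complex.arg_ofReal_of_neg (by linarith [hpos.2]), Complex.ofReal_im]
      linarith [Real.pi_pos]

theorem IsStabilitySwitch.exists_near {a₁₁ a₁₂ a₂₁ a₂₂ τ : ℝ}
    (h : IsStabilitySwitch a₁₁ a₁₂ a₂₁ a₂₂ τ) {ε : ℝ} (hε : 0 < ε) :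
    (∃ s, 0 < s ∧ τ - ε < s ∧ s < τ + ε ∧ DyadStable a₁₁ a₁₂ a₂₁ a₂₂ s) ∧
      ∃ u, 0 < u ∧ τ - ε < u ∧ u < τ + ε ∧ DyadUnstable a₁₁ a₁₂ a₂₁ a₂₂ u := by
  obtain ⟨h0, h⟩ := h
  have hn : ∀ᶠ s in 𝓝 τ, 0 < s ∧ τ - ε < s ∧ s < τ + ε :=
    (lt_mem_nhds h0).and ((lt_mem_nhds (by linarith)).and (gt_mem_nhds (by linarith)))
  have key : ∀ (P : ℝ → Prop) (S : Set ℝ) [(𝓝[S] τ).NeBot], (∀ᶠ s in 𝓝[S] τ, P s) →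
      ∃ s, 0 < s ∧ τ - ε < s ∧ s < τ + ε ∧ P s := by
    intro P S _ hP
    obtain ⟨s, hs, hPs⟩ := ((hn.filter_mono nhdsWithin_le_nhds).and hP).exists
    exact ⟨s, hs.1, hs.2.1, hs.2.2, hPs⟩
  rcases h with ⟨h1, h2⟩ | ⟨h1, h2⟩
  · exact ⟨key _ _ h1, key _ _ h2⟩
  · exact ⟨key _ _ h2, key _ _ h1⟩

theorem dyadUnstable_of_large_pos_coupling {a₁₁ a₁₂ a₂₁ a₂₂ τ : ℝ} (hτ : 0 ≤ τ)
    (hk : 0 < a₁₂ * a₂₁) (h : |a₁₁ * a₂₂| < |a₁₂ * a₂₁|) : DyadUnstable a₁₁ a₁₂ a₂₁ a₂₂ τ := by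
  rw [abs_of_pos hk] at h
  have := (le_abs_self _).trans_lt h
  refine dyadUnstable_of_real hτ le_rfl ?_ this.ne
  simp
  linarith

theorem dyadUnstable_of_trace_pos {a₁₁ a₁₂ a₂₁ a₂₂ τ : ℝ} (hτ : 0 ≤ τ)
    (hk : a₁₂ * a₂₁ < 0) (h : |a₁₁ * a₂₂| < -(a₁₂ * a₂₁)) (htr : 0 < a₁₁ + a₂₂) :
    DyadUnstable a₁₁ a₁₂ a₂₁ a₂₂ τ := by
  refine dyadUnstable_of_charPhase hτ hk ?_
  have him := levelPoint_zero_im_pos h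
  have := pi_lt_arg_add_arg him htr
  have h2 := mul_nonneg hτ him.le
  unfold charPhase
  refine this.trans_le ?_
  exact le_add_of_nonneg_right h2

theorem dyadStable_of_lt_criticalDelay {a₁₁ a₁₂ a₂₁ a₂₂ τ : ℝ} (hτ : 0 ≤ τ)
    (h : |a₁₁ * a₂₂| < -(a₁₂ * a₂₁)) (htr : a₁₁ + a₂₂ < 0)
    (hlt : τ < criticalDelay a₁₁ a₂₂ (-(a₁₂ * a₂₁))) : DyadStable a₁₁ a₁₂ a₂₁ a₂₂ τ := by
  refine dyadStable_of_no_root hτ fun z hz => ?_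
  rw [dyadChar_eq_add]
  exact no_root_of_lt_criticalDelay h htr hτ hlt hz

theorem center_of_trace_zero {a₁₁ a₁₂ a₂₁ a₂₂ : ℝ} (h : |a₁₁ * a₂₂| < -(a₁₂ * a₂₁))
    (htr : a₁₁ + a₂₂ = 0) :
    ¬ DyadStable a₁₁ a₁₂ a₂₁ a₂₂ 0 ∧ ¬ DyadUnstable a₁₁ a₁₂ a₂₁ a₂₂ 0 := by
  have hdet : 0 < a₁₁ * a₂₂ - a₁₂ * a₂₁ := by linarith [neg_abs_le (a₁₁ * a₂₂)]
  refine ⟨not_dyadStable_of_root (z := Complex.I * √(a₁₁ * a₂₂ - a₁₂ * a₂₁)) ?_ (by simp),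
    not_dyadUnstable_of_center htr hdet ?_⟩
  · have h1 : ((√(a₁₁ * a₂₂ - a₁₂ * a₂₁) : ℝ) : ℂ) ^ 2 = a₁₁ * a₂₂ - a₁₂ * a₂₁ := by
      exact_mod_cast congrArg (fun x : ℝ => (x : ℂ)) (Real.sq_sqrt hdet.le)
    have h2 : (a₁₁ : ℂ) + a₂₂ = 0 := by exact_mod_cast congrArg (fun x : ℝ => (x : ℂ)) htr
    simp only [dyadChar, Complex.ofReal_zero, mul_zero, Complex.exp_zero, mul_one]
    linear_combination (Complex.I ^ 2) * h1 + (a₁₁ * a₂₂ - a₁₂ * a₂₁ : ℂ) * Complex.I_sq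
      - Complex.I * √(a₁₁ * a₂₂ - a₁₂ * a₂₁) * h2
  · rintro rfl
    simp at h
    linarith [abs_nonneg a₁₁, mul_nonneg (abs_nonneg a₁₁) (abs_nonneg a₂₂)]

theorem theorem3 (a₁₁ a₁₂ a₂₁ a₂₂ : ℝ) :
    (|a₁₂ * a₂₁| < |a₁₁ * a₂₂| →
      (∀ τ : ℝ, ¬ IsStabilitySwitch a₁₁ a₁₂ a₂₁ a₂₂ τ) ∧
        ((∀ τ : ℝ, 0 ≤ τ → DyadStable a₁₁ a₁₂ a₂₁ a₂₂ τ) ∨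
          (∀ τ : ℝ, 0 ≤ τ → DyadUnstable a₁₁ a₁₂ a₂₁ a₂₂ τ))) ∧
    (|a₁₁ * a₂₂| < |a₁₂ * a₂₁| →
      (DyadUnstable a₁₁ a₁₂ a₂₁ a₂₂ 0 →
        ∀ τ : ℝ, 0 ≤ τ → DyadUnstable a₁₁ a₁₂ a₂₁ a₂₂ τ) ∧
      (DyadStable a₁₁ a₁₂ a₂₁ a₂₂ 0 →
        ∃ τc : ℝ, IsStabilitySwitch a₁₁ a₁₂ a₂₁ a₂₂ τc ∧
          (∀ τ : ℝ, IsStabilitySwitch a₁₁ a₁₂ a₂₁ a₂₂ τ → τ = τc) ∧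
          (∀ τ : ℝ, 0 ≤ τ → τ < τc → DyadStable a₁₁ a₁₂ a₂₁ a₂₂ τ) ∧
          (∀ τ : ℝ, τc < τ → DyadUnstable a₁₁ a₁₂ a₂₁ a₂₂ τ))) := by
  refine ⟨fun h => ?_, fun h => ?_⟩
  · by_cases hneg : a₁₁ < 0 ∧ a₂₂ < 0
    · have hst : ∀ τ : ℝ, 0 ≤ τ → DyadStable a₁₁ a₁₂ a₂₁ a₂₂ τ :=
        fun τ hτ => dyadStable_of_small_coupling hτ hneg.1 hneg.2 h
      refine ⟨fun τ hsw => ?_, Or.inl hst⟩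
      obtain ⟨-, u, hu, -, -, hun⟩ := hsw.exists_near one_pos
      exact hun.not_dyadStable hu.le (hst u hu.le)
    · have hun : ∀ τ : ℝ, 0 ≤ τ → DyadUnstable a₁₁ a₁₂ a₂₁ a₂₂ τ :=
        fun τ hτ => dyadUnstable_of_small_coupling hτ hneg h
      refine ⟨fun τ hsw => ?_, Or.inr hun⟩
      obtain ⟨⟨s, hs, -, -, hst⟩, -⟩ := hsw.exists_near one_pos
      exact (hun s hs.le).not_dyadStable hs.le hst
  · rcases lt_or_ge 0 (a₁₂ * a₂₁) with hk | hk
    · have hun : ∀ τ : ℝ, 0 ≤ τ → DyadUnstable a₁₁ a₁₂ a₂₁ a₂₂ τ :=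
        fun τ hτ => dyadUnstable_of_large_pos_coupling hτ hk h
      exact ⟨fun _ => hun, fun hst => absurd hst ((hun 0 le_rfl).not_dyadStable le_rfl)⟩
    · rw [abs_of_nonpos hk] at h
      have hk' : a₁₂ * a₂₁ < 0 := by linarith [abs_nonneg (a₁₁ * a₂₂)]
      rcases lt_trichotomy (a₁₁ + a₂₂) 0 with htr | htr | htr
      · set τc := criticalDelay a₁₁ a₂₂ (-(a₁₂ * a₂₁)) with hτc
        have hpos : 0 < τc := criticalDelay_pos h htr
        have hst : ∀ τ : ℝ, 0 ≤ τ → τ < τc → DyadStable a₁₁ a₁₂ a₂₁ a₂₂ τ :=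
          fun τ hτ hlt => dyadStable_of_lt_criticalDelay hτ h htr hlt
        have hun : ∀ τ : ℝ, τc < τ → DyadUnstable a₁₁ a₁₂ a₂₁ a₂₂ τ := fun τ hlt =>
          dyadUnstable_of_charPhase (hpos.trans hlt).le hk' ((pi_lt_charPhase_iff h).2 hlt)
        refine ⟨fun hu => absurd (hst 0 le_rfl hpos) (hu.not_dyadStable le_rfl), fun _ =>
          ⟨τc, ⟨hpos, Or.inl ⟨?_, ?_⟩⟩, fun τ hsw => ?_, hst, hun⟩⟩
        · filter_upwards [Ico_mem_nhdsLT hpos] with τ hτ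
          exact hst τ hτ.1 hτ.2
        · filter_upwards [self_mem_nhdsWithin] with τ hτ
          exact hun τ hτ
        · rcases lt_trichotomy τ τc with hlt | heq | hlt
          -- A window of radius `τc - τ` around `τ` stays below `τc`, where every nonnegative delay
          -- is stable.
          · obtain ⟨-, u, hu, -, hlt', hunu⟩ := hsw.exists_near (sub_pos.2 hlt)
            exact absurd (hst u hu.le (by linarith)) (hunu.not_dyadStable hu.le)
          · exact heq
          · obtain ⟨⟨s, hs, hlt', -, hsts⟩, -⟩ := hsw.exists_near (sub_pos.2 hlt)
            exact absurd hsts ((hun s (by linarith)).not_dyadStable hs.le)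
      · obtain ⟨hns, hnu⟩ := center_of_trace_zero h htr
        exact ⟨fun hu => absurd hu hnu, fun hst => absurd hst hns⟩
      · have hun : ∀ τ : ℝ, 0 ≤ τ → DyadUnstable a₁₁ a₁₂ a₂₁ a₂₂ τ :=
          fun τ hτ => dyadUnstable_of_trace_pos hτ hk' h htr
        exact ⟨fun _ => hun, fun hst => absurd hst ((hun 0 le_rfl).not_dyadStable le_rfl)⟩
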